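/- **Setting.** For $p\ge 1$, $\lambda\in\mathbb{R}$ let $\Psi(t)=t^p\log^\lambda(e+t)$, $t\ge 0$. For an open set $\Omega\subset\mathbb{R}^2$, $L^\Psi(\Omega)$ is the set of (classes of a.e. equal) measurable functions $u$ on $\Omega$ with $\int_\Omega\Psi(\alpha|u|)\,dx<\infty$ for some $\alpha>0$, and $W^{1,\Psi}(\Omega)$ is the set of $u\in L^\Psi(\Omega)$ whose weak partial derivatives $\partial_1u,\partial_2u$ exist and lie in $L^\Psi(\Omega)$. A compact set $E\subset(0,1)$ is viewed as the subset $E\times\{0\}$ of $\mathbb{R}^2$, and $E$ is called $(p,\lambda)$-removable if $W^{1,\Psi}(\mathbb{R}^2\setminus E)=W^{1,\Psi}(\mathbb{R}^2)$ as sets. For $I=(a,b)$ and $c>0$, $cI$ denotes the open interval of length $c(b-a)$ with the same centre as $I$. $H^1$ is the one-dimensional Hausdorff measure. **Theorem.** Let $E\subset(0,1)$ be compact with $(0,1)\setminus E=\bigcup_j I_j$, where $(I_j)$ is a finite or countably infinite family of pairwise disjoint non-empty open intervals. Suppose that one of the following holds. 1. Either $1<p<2$ and $\lambda\in\mathbb{R}$,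 or $p=1$ and $\lambda\ge 0$; and $$H^1(E)>0,\qquad \sum_j H^1(I_j)^{2-p}\log^{\lambda}\bigl(1/H^1(I_j)\bigr)<\infty .$$ 2. $p=2$, $\lambda<1$, and $$H^1\Bigl((0,1)\setminus\bigcup_j H^1(I_j)^{-1/2}I_j\Bigr)>0,\qquad \sum_j\log^{\lambda-1}\bigl(1/H^1(I_j)\bigr)<\infty .$$ 3. $p=2$, $\lambda=1$, and, with $R_j=\exp\bigl(-(\log(1/H^1(I_j)))^{1/2}\bigr)$, $$H^1(E)>0,\qquad H^1\Bigl((0,1)\setminus\bigcup_j \tfrac{R_j}{H^1(I_j)}I_j\Bigr)>0,\qquad \sum_j\bigl(\log\log(1/H^1(I_j))\bigr)^{-1}\ \text{converges absolutely},$$ where in the last sum the (at most two) undefined terms with $H^1(I_j)=1/e$ are omitted. Then $E$ is not $(p,\lambda)$-removable. -/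

import Mathlib

open MeasureTheory Set
open scoped ENNReal

noncomputable section

/-- The function `Ψ(t) = t ^ p * log ^ lam (e + t)`, used for `t ≥ 0`. -/
def orliczFun (p lam : ℝ) (t : ℝ) : ℝ :=
  t ^ p * Real.log (Real.exp 1 + t) ^ lam

/-- `u` belongs to the Orlicz space `L^Ψ(Ω)`: it is (a.e.) measurable on `Ω` and
`∫_Ω Ψ(α |u|) < ∞` for some `α > 0`. Only the values of `u` on `Ω` matter. -/
def MemOrlicz {n : ℕ} (Psi : ℝ → ℝ) (Ω : Set (EuclideanSpace ℝ (Fin n)))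
    (u : EuclideanSpace ℝ (Fin n) → ℝ) : Prop :=
  AEMeasurable u (volume.restrict Ω) ∧
    ∃ α : ℝ, 0 < α ∧ ∫⁻ x in Ω, ENNReal.ofReal (Psi (α * |u x|)) < ∞

/-- `g` is the weak (distributional) partial derivative `∂_j u` in the open set `Ω`. -/
def IsWeakPartialDeriv {n : ℕ} (Ω : Set (EuclideanSpace ℝ (Fin n))) (j : Fin n)
    (u g : EuclideanSpace ℝ (Fin n) → ℝ) : Prop :=
  LocallyIntegrableOn u Ω ∧ LocallyIntegrableOn g Ω ∧
    ∀ φ : EuclideanSpace ℝ (Fin n) → ℝ, ContDiff ℝ 1 φ → HasCompactSupport φ → tsupport φ ⊆ Ω →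
      ∫ x in Ω, u x * fderiv ℝ φ x (EuclideanSpace.single j 1) = -∫ x in Ω, φ x * g x

/-- The Orlicz-Sobolev space `W^{1,Ψ}(Ω)`. Its elements are represented by functions on the whole
of `ℝⁿ`, on which membership depends only through their restriction to `Ω`, up to null sets. -/
def orliczSobolev {n : ℕ} (Psi : ℝ → ℝ) (Ω : Set (EuclideanSpace ℝ (Fin n))) :
    Set (EuclideanSpace ℝ (Fin n) → ℝ) :=
  {u | MemOrlicz Psi Ω u ∧ ∀ j : Fin n, ∃ g, MemOrlicz Psi Ω g ∧ IsWeakPartialDeriv Ω j u g}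

/-- Removability of a closed Lebesgue-null set `K ⊆ ℝⁿ` for `W^{1,Ψ}`:
`W^{1,Ψ}(ℝⁿ \ K) = W^{1,Ψ}(ℝⁿ)` as sets. -/
def IsOrliczRemovable {n : ℕ} (Psi : ℝ → ℝ) (K : Set (EuclideanSpace ℝ (Fin n))) : Prop :=
  orliczSobolev Psi Kᶜ = orliczSobolev Psi univ

/-- The set `E ⊆ ℝ` regarded as the subset `E × {0}` of the plane. -/
def lineInPlane (E : Set ℝ) : Set (EuclideanSpace ℝ (Fin 2)) :=
  {x | x 0 ∈ E ∧ x 1 = 0}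

/-- `(p, lam)`-removability of `E ⊆ ℝ ⊆ ℝ²`. -/
def IsPLRemovable (p lam : ℝ) (E : Set ℝ) : Prop :=
  IsOrliczRemovable (orliczFun p lam) (lineInPlane E)

/-- For `I = (a, b)`, the concentric interval `c I` of length `c (b - a)`. -/
def dilateIoo (c a b : ℝ) : Set ℝ :=
  Ioo ((a + b) / 2 - c * (b - a) / 2) ((a + b) / 2 + c * (b - a) / 2)

/-- `R = exp (-(log (1 / ℓ)) ^ (1 / 2))` for an interval of length `ℓ`. -/
def gapRadius (l : ℝ) : ℝ :=
  Real.exp (-Real.sqrt (Real.log (1 / l)))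

end

/-! The obstruction to removability is a jump across `E`. Around each gap, of length `l`, take a
radial capacity profile: a Lipschitz function that is 0 on the disk having the gap as diameter and 1
outside a larger disk of radius `ρ`. Let `u` be 0 in the closed lower half-plane and, above it, the
infimum of these profiles and a compactly supported cutoff. Across a gap some member of the family
vanishes on a full neighbourhood, so `u` has no jump there and is locally Lipschitz off `E`
(`locallyLipschitzOn_upperInf`).

At almost every point where `u` is differentiable and positive height is attained, its gradient is
that of a member realising the infimum. The Orlicz energy of `u` is therefore at most the sum of the
energies of the members (`lintegral_fderiv_upperInf_le`). If the radii are summable, the larger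
disks of all but finitely many gaps cover less than the length of `E`; the remaining gaps are
handled by the cutoff. Then `u = 1` just above a subset of `E` of positive length and `u = 0` below,
which excludes a weak vertical derivative in the whole plane (`not_isWeakPartialDeriv_of_jump`).
This is the criterion `not_isPLRemovable_of_isCapacityProfile`.

The three cases differ only in the profile. With `L = log (1 / l)`, a linear profile up to radius
`l` costs about `l ^ (2 - p) * L ^ lam`. For `p = 2` a logarithmic profile up to radius `√l / 2`
costs about `L ^ (lam - 1)`. For `p = 2`, `lam = 1` an iterated logarithm up to `gapRadius l` costs
about `1 / log L`. All three come from `exists_isCapacityProfile`, and the assumed series bound the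
energies. -/

/-! ### Locally Lipschitz functions and their weak derivatives -/

open Filter Topology in
/-- A locally Lipschitz function with compact support is Lipschitz. -/
theorem LocallyLipschitz.exists_lipschitzWith_of_hasCompactSupport {X : Type*}
    [NormedAddCommGroup X] [ProperSpace X] {f : X → ℝ} (hf : LocallyLipschitz f)
    (hc : HasCompactSupport f) : ∃ C, LipschitzWith C f := by
  obtain ⟨R, hR⟩ := hc.isCompact.isBounded.subset_closedBall 0
  -- The unit margin beyond `R` matters: a point outside the larger ball is at distance at least 1
  -- from the support, so there the sup bound `M` acts as a Lipschitz constant.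
  obtain ⟨K, hK⟩ := LocallyLipschitzOn.exists_lipschitzOnWith_of_compact
    (isCompact_closedBall (0 : X) (R + 1)) (hf.locallyLipschitzOn (s := Metric.closedBall 0 (R + 1)))
  obtain ⟨M, hM⟩ := hc.exists_bound_of_continuous hf.continuous
  have hM0 : 0 ≤ M := (norm_nonneg _).trans (hM 0)
  have hout : ∀ x, x ∉ Metric.closedBall (0 : X) R → f x = 0 := fun x hx =>
    image_eq_zero_of_notMem_tsupport fun h => hx (hR h)
  have key : ∀ x y, x ∈ Metric.closedBall (0 : X) R →
      dist (f x) (f y) ≤ (K + M) * dist x y := by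
    intro x y hx
    have hx' : x ∈ Metric.closedBall (0 : X) (R + 1) :=
      Metric.closedBall_subset_closedBall (by linarith) hx
    have hd : 0 ≤ dist x y := dist_nonneg
    by_cases hy : y ∈ Metric.closedBall (0 : X) (R + 1)
    · have := hK.dist_le_mul x hx' y hy
      nlinarith [mul_nonneg hM0 hd]
    · have hy0 : f y = 0 := hout y fun h =>
        hy (Metric.closedBall_subset_closedBall (by linarith) h)
      rw [hy0, dist_zero_right]
      have h1 : 1 ≤ dist x y := by
        simp only [Metric.mem_closedBall, not_le] at hx hy
        have := dist_triangle y x 0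
        rw [dist_comm y x] at this
        linarith
      have := hM x
      nlinarith [K.coe_nonneg, mul_nonneg K.coe_nonneg hd]
  refine ⟨K + ⟨M, hM0⟩, LipschitzWith.of_dist_le_mul fun x y => ?_⟩
  change dist (f x) (f y) ≤ (K + M) * dist x y
  by_cases hx : x ∈ Metric.closedBall (0 : X) R
  · exact key x y hx
  by_cases hy : y ∈ Metric.closedBall (0 : X) R
  · rw [dist_comm, dist_comm x]; exact key y x hy
  · rw [hout x hx, hout y hy, dist_self]
    have : 0 ≤ (K : ℝ) := K.coe_nonneg
    positivity

/-- Products of real-valued locally Lipschitz functions are locally Lipschitz. -/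
theorem LocallyLipschitzOn.mul_real {X : Type*} [PseudoMetricSpace X] {s : Set X} {f g : X → ℝ}
    (hf : LocallyLipschitzOn s f) (hg : LocallyLipschitzOn s g) :
    LocallyLipschitzOn s fun x => f x * g x := by
  intro x hx
  obtain ⟨K, t, ht, hK⟩ := hf hx
  obtain ⟨K', t', ht', hK'⟩ := hg hx
  have hm : ContDiff ℝ 1 fun q : ℝ × ℝ => q.1 * q.2 := contDiff_fst.mul contDiff_snd
  obtain ⟨M, w, hw, hM⟩ := hm.locallyLipschitz (f x, g x)
  refine ⟨M * max K K', (t ∩ t') ∩ (s ∩ (fun y => (f y, g y)) ⁻¹' w), ?_, ?_⟩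
  · refine Filter.inter_mem (Filter.inter_mem ht ht') (Filter.inter_mem self_mem_nhdsWithin ?_)
    exact ((hf.continuousOn x hx).prodMk (hg.continuousOn x hx)) hw
  · exact hM.comp ((hK.mono fun y hy => hy.1.1).prodMk (hK'.mono fun y hy => hy.1.2))
      fun y hy => hy.2.2

/-- A function that is locally Lipschitz on an open set is differentiable at almost all of its
points. -/
theorem LocallyLipschitzOn.ae_differentiableAt {n : ℕ} {Ω : Set (EuclideanSpace ℝ (Fin n))}
    (hΩ : IsOpen Ω) {u : EuclideanSpace ℝ (Fin n) → ℝ} (hu : LocallyLipschitzOn Ω u) :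
    ∀ᵐ x, x ∈ Ω → DifferentiableAt ℝ u x := by
  rw [ae_iff]
  refine measure_null_of_locally_null _ fun x hx => ?_
  simp only [Classical.not_imp, mem_ofPred_eq] at hx
  obtain ⟨K, t, ht, hK⟩ := hu hx.1
  rw [hΩ.nhdsWithin_eq hx.1] at ht
  refine ⟨interior t ∩ {a | ¬(a ∈ Ω → DifferentiableAt ℝ u a)},
    Filter.inter_mem (mem_nhdsWithin_of_mem_nhds (interior_mem_nhds.2 ht)) self_mem_nhdsWithin, ?_⟩
  have h := (hK.mono interior_subset).ae_differentiableWithinAt_of_mem (μ := volume)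
  rw [ae_iff] at h
  refine measure_mono_null ?_ h
  rintro z ⟨hz, hz'⟩
  simp only [mem_ofPred_eq, Classical.not_imp] at hz' ⊢
  refine ⟨hz, fun hd => hz'.2 ?_⟩
  exact hd.differentiableAt (isOpen_interior.mem_nhds hz)

/-- The classical partial derivatives of a locally Lipschitz function are its weak ones. -/
theorem LocallyLipschitzOn.isWeakPartialDeriv_fderiv {n : ℕ}
    {Ω : Set (EuclideanSpace ℝ (Fin n))}
    (hΩ : IsOpen Ω) {u : EuclideanSpace ℝ (Fin n) → ℝ} (hu : LocallyLipschitzOn Ω u)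
    (j : Fin n) :
    IsWeakPartialDeriv Ω j u (fun x => fderiv ℝ u x (EuclideanSpace.single j 1)) := by
  set v : EuclideanSpace ℝ (Fin n) := EuclideanSpace.single j 1
  refine ⟨hu.continuousOn.locallyIntegrableOn hΩ.measurableSet, ?_, ?_⟩
  · intro x hx
    obtain ⟨K, t, ht, hK⟩ := hu hx
    rw [hΩ.nhdsWithin_eq hx] at ht
    obtain ⟨r, hr, hrt⟩ := Metric.mem_nhds_iff.1 ht
    refine ⟨Metric.ball x r, mem_nhdsWithin_of_mem_nhds (Metric.ball_mem_nhds x hr), ?_⟩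
    refine Measure.integrableOn_of_bounded (M := K * ‖v‖) measure_ball_lt_top.ne
      (measurable_fderiv_apply_const ℝ u v).aestronglyMeasurable ?_
    refine (ae_restrict_iff' measurableSet_ball).2 (Filter.Eventually.of_forall fun z hz => ?_)
    exact ((fderiv ℝ u z).le_opNorm v).trans (mul_le_mul_of_nonneg_right
      (norm_fderiv_le_of_lipschitzOn ℝ (Metric.isOpen_ball.mem_nhds hz) (hK.mono hrt))
      (norm_nonneg _))
  · intro φ hφ hc hs
    set w : EuclideanSpace ℝ (Fin n) → ℝ := fun x => φ x * u x with hw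
    have hwc : HasCompactSupport w := hc.mul_right
    have hsw : tsupport w ⊆ tsupport φ := closure_mono fun x hx => by
      simp only [Function.mem_support, hw] at hx ⊢
      exact left_ne_zero_of_mul hx
    have hwl : LocallyLipschitz w := by
      intro x
      by_cases hx : x ∈ Ω
      · obtain ⟨K, t, ht, hK⟩ := (hφ.locallyLipschitz.locallyLipschitzOn (s := Ω)).mul_real hu hx
        rw [hΩ.nhdsWithin_eq hx] at ht
        exact ⟨K, t, ht, hK⟩
      · refine ⟨0, (tsupport φ)ᶜ, (isClosed_tsupport φ).isOpen_compl.mem_nhds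
          fun h => hx (hs h), ?_⟩
        refine LipschitzOnWith.of_dist_le_mul fun y hy z hz => ?_
        simp [hw, image_eq_zero_of_notMem_tsupport hy, image_eq_zero_of_notMem_tsupport hz]
    obtain ⟨C, hC⟩ := hwl.exists_lipschitzWith_of_hasCompactSupport hwc
    have h0 : ∫ x, lineDeriv ℝ w x v = 0 := by
      -- Integration by parts against the constant 1, whose derivative vanishes.
      have := LipschitzWith.integral_lineDeriv_mul_eq (μ := volume)
        (LipschitzWith.const (1 : ℝ)) hC hwc (-v)
      simp only [neg_neg, mul_one] at this
      rw [← this]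
      simp [lineDeriv]
    have hz : ∀ x, x ∉ tsupport φ → lineDeriv ℝ w x v = 0 := by
      intro x hx
      have : w =ᶠ[nhds x] fun _ => 0 :=
        notMem_tsupport_iff_eventuallyEq.1 fun h => hx (hsw h)
      rw [Filter.EventuallyEq.lineDeriv_eq this]
      simp [lineDeriv]
    have hwi : Integrable (fun x => lineDeriv ℝ w x v) := by
      refine (integrableOn_iff_integrable_of_support_subset (s := tsupport φ) fun x hx => ?_).1
        ((hC.locallyIntegrable_lineDeriv v).integrableOn_isCompact hc.isCompact)
      by_contra h
      exact hx (hz x h)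
    have h1 : ∫ x in Ω, lineDeriv ℝ w x v = 0 := by
      rw [setIntegral_eq_integral_of_forall_compl_eq_zero, h0]
      exact fun x hx => hz x fun h => hx (hs h)
    have hui : Integrable fun x => u x * fderiv ℝ φ x v := by
      refine (integrableOn_iff_integrable_of_support_subset (s := tsupport φ) fun x hx => ?_).1
        (ContinuousOn.integrableOn_compact hc.isCompact ((hu.continuousOn.mono hs).mul
          ((hφ.continuous_fderiv one_ne_zero).clm_apply continuous_const).continuousOn))
      by_contra h
      have : fderiv ℝ φ x = 0 := image_eq_zero_of_notMem_tsupport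
        fun h' => h (tsupport_fderiv_subset ℝ h')
      exact hx (by simp [this])
    have hpt : (fun x => lineDeriv ℝ w x v) =ᵐ[volume.restrict Ω]
        fun x => u x * fderiv ℝ φ x v + φ x * fderiv ℝ u x v := by
      refine (ae_restrict_iff' hΩ.measurableSet).2 ?_
      filter_upwards [hu.ae_differentiableAt hΩ] with x hx hxΩ
      have hd := (hφ.differentiable one_ne_zero).differentiableAt.hasFDerivAt.mul (hx hxΩ).hasFDerivAt
      have : HasFDerivAt w _ x := hd
      rw [this.differentiableAt.lineDeriv_eq_fderiv, this.fderiv]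
      simp
      ring
    have hgi : IntegrableOn (fun x => φ x * fderiv ℝ u x v) Ω := by
      refine ((hwi.integrableOn (s := Ω)).sub hui.integrableOn).congr ?_
      filter_upwards [hpt] with x hx
      simp only [Pi.sub_apply, hx]
      ring
    rw [integral_congr_ae hpt, integral_add hui.integrableOn hgi] at h1
    linarith

/-! ### A jump across a segment excludes a weak derivative -/

/-- A smooth function on the line, equal to `1` on `[-1, 1]`, supported in `[-2, 2]`, and
nonincreasing on `[0, ∞)`. -/
noncomputable def lineCutoff (s : ℝ) : ℝ := Real.smoothTransition (2 - s) * Real.smoothTransition (2 + s)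

theorem contDiff_lineCutoff : ContDiff ℝ 1 lineCutoff :=
  (Real.smoothTransition.contDiff.comp (contDiff_const.sub contDiff_id)).mul
    (Real.smoothTransition.contDiff.comp (contDiff_const.add contDiff_id))

theorem lineCutoff_eq_one {s : ℝ} (h : |s| ≤ 1) : lineCutoff s = 1 := by
  obtain ⟨h1, h2⟩ := abs_le.1 h
  rw [lineCutoff, Real.smoothTransition.one_of_one_le (by linarith),
    Real.smoothTransition.one_of_one_le (by linarith), mul_one]

theorem lineCutoff_eq_zero {s : ℝ} (h : 2 ≤ |s|) : lineCutoff s = 0 := by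
  rcases le_abs.1 h with h | h
  · rw [lineCutoff, Real.smoothTransition.zero_of_nonpos (by linarith), zero_mul]
  · rw [lineCutoff, Real.smoothTransition.zero_of_nonpos (x := 2 + s) (by linarith), mul_zero]

theorem lineCutoff_nonneg (s : ℝ) : 0 ≤ lineCutoff s :=
  mul_nonneg (Real.smoothTransition.nonneg _) (Real.smoothTransition.nonneg _)

theorem lineCutoff_le_one (s : ℝ) : lineCutoff s ≤ 1 :=
  mul_le_one₀ (Real.smoothTransition.le_one _) (Real.smoothTransition.nonneg _)
    (Real.smoothTransition.le_one _)

theorem deriv_lineCutoff_nonpos {s : ℝ} (h : 0 ≤ s) : deriv lineCutoff s ≤ 0 := by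
  have h1 : lineCutoff =ᶠ[nhds s] fun t => Real.smoothTransition (2 - t) := by
    filter_upwards [lt_mem_nhds (show (-1 : ℝ) < s by linarith)] with t ht
    rw [lineCutoff, Real.smoothTransition.one_of_one_le (x := 2 + t) (by linarith), mul_one]
  rw [h1.deriv_eq, deriv_comp_const_sub]
  exact neg_nonpos.2 Real.smoothTransition.monotone.deriv_nonneg

theorem integral_plane_mul (f k : ℝ → ℝ) :
    ∫ z : EuclideanSpace ℝ (Fin 2), f (z 0) * k (z 1) = (∫ x, f x) * ∫ y, k y := by
  have h1 := (PiLp.volume_preserving_ofLp (Fin 2)).integral_comp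
    (MeasurableEquiv.toLp 2 (Fin 2 → ℝ)).symm.measurableEmbedding
    (fun z : Fin 2 → ℝ => f (z 0) * k (z 1))
  have h2 := integral_fintype_prod_volume_eq_prod (𝕜 := ℝ) (E := fun _ : Fin 2 => ℝ) ![f, k]
  simp only [Fin.prod_univ_two, Matrix.cons_val_zero, Matrix.cons_val_one] at h2
  rw [← h2, ← h1]

/-- A smooth cutoff of the strip of height `e` around the unit interval in the plane. -/
noncomputable def stripCutoff (e : ℝ) (z : EuclideanSpace ℝ (Fin 2)) : ℝ :=
  lineCutoff (z 0) * lineCutoff (z 1 / e)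

theorem contDiff_coord {n : ℕ} (i : Fin n) :
    ContDiff ℝ 1 fun z : EuclideanSpace ℝ (Fin n) => z i :=
  (EuclideanSpace.proj (𝕜 := ℝ) i).contDiff

theorem contDiff_stripCutoff (e : ℝ) : ContDiff ℝ 1 (stripCutoff e) :=
  (contDiff_lineCutoff.comp (contDiff_coord 0)).mul
    (contDiff_lineCutoff.comp ((contDiff_coord 1).div_const e))

theorem isCompact_plane_box (a b c d : ℝ) :
    IsCompact {z : EuclideanSpace ℝ (Fin 2) | z 0 ∈ Icc a b ∧ z 1 ∈ Icc c d} := by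
  have h1 : IsCompact (univ.pi ![Icc a b, Icc c d] : Set (Fin 2 → ℝ)) :=
    isCompact_univ_pi fun i => by fin_cases i <;> exact isCompact_Icc
  have h2 := (EuclideanSpace.equiv (Fin 2) ℝ).toHomeomorph.isCompact_preimage.2 h1
  convert h2 using 1
  ext z
  simp [Set.mem_pi, Fin.forall_fin_two]

theorem stripCutoff_eq_zero {e : ℝ} (he : 0 < e) {z : EuclideanSpace ℝ (Fin 2)}
    (hz : ¬ (z 0 ∈ Icc (-2) 2 ∧ z 1 ∈ Icc (-2 * e) (2 * e))) : stripCutoff e z = 0 := by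
  rw [not_and_or] at hz
  rw [stripCutoff]
  rcases hz with hz | hz
  · rw [lineCutoff_eq_zero, zero_mul]
    by_contra! h
    exact hz ⟨(abs_lt.1 h).1.le, (abs_lt.1 h).2.le⟩
  · rw [lineCutoff_eq_zero (s := z 1 / e), mul_zero]
    by_contra! h
    rw [abs_div, abs_of_pos he, div_lt_iff₀ he] at h
    exact hz ⟨by have := (abs_lt.1 h).1; linarith, (abs_lt.1 h).2.le⟩

theorem hasCompactSupport_stripCutoff {e : ℝ} (he : 0 < e) :
    HasCompactSupport (stripCutoff e) :=
  HasCompactSupport.intro (isCompact_plane_box (-2) 2 (-2 * e) (2 * e)) fun _ hz =>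
    stripCutoff_eq_zero he hz

theorem fderiv_stripCutoff (e : ℝ) (z : EuclideanSpace ℝ (Fin 2)) :
    fderiv ℝ (stripCutoff e) z (EuclideanSpace.single 1 1) =
      lineCutoff (z 0) * (deriv lineCutoff (z 1 / e) / e) := by
  have hd := contDiff_lineCutoff.differentiable one_ne_zero
  rw [← ((contDiff_stripCutoff e).differentiable one_ne_zero).differentiableAt.lineDeriv_eq_fderiv,
    lineDeriv]
  have h1 : (fun t : ℝ => stripCutoff e (z + t • EuclideanSpace.single 1 1)) =
      fun t => lineCutoff (z 0) * lineCutoff ((z 1 + t) / e) := by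
    funext t
    simp [stripCutoff]
  rw [h1]
  have h2 : HasDerivAt (fun t : ℝ => (z 1 + t) / e) (1 / e) 0 :=
    ((hasDerivAt_id (0 : ℝ)).const_add (z 1)).div_const e
  have h3 : HasDerivAt lineCutoff (deriv lineCutoff (z 1 / e)) ((z 1 + 0) / e) := by
    rw [add_zero]; exact (hd _).hasDerivAt
  refine (((h3.comp (0 : ℝ) h2).const_mul (lineCutoff (z 0))).deriv).trans ?_
  ring

/-- The mass is `lineCutoff 0 - lineCutoff 2`, independently of `e`; this keeps the jump visible as
the strip shrinks. -/
theorem integral_deriv_lineCutoff {e : ℝ} (he : 0 < e) :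
    ∫ y, (Ioc 0 (2 * e)).indicator (fun y => -(deriv lineCutoff (y / e) / e)) y = 1 := by
  have hd := contDiff_lineCutoff.differentiable one_ne_zero
  rw [integral_indicator measurableSet_Ioc, ← intervalIntegral.integral_of_le (by positivity)]
  have h : ∀ y ∈ uIcc 0 (2 * e), HasDerivAt (fun y => -lineCutoff (y / e))
      (-(deriv lineCutoff (y / e) / e)) y := fun y _ => by
    have h2 : HasDerivAt (fun t : ℝ => t / e) (1 / e) y := (hasDerivAt_id y).div_const e
    have := ((hd (y / e)).hasDerivAt.comp y h2).neg
    rwa [mul_one_div] at this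
  rw [intervalIntegral.integral_eq_sub_of_hasDerivAt h]
  · rw [zero_div, lineCutoff_eq_one (s := 0) (by simp), lineCutoff_eq_zero]
    · ring
    · rw [mul_div_cancel_right₀ _ he.ne']
      exact le_abs_self _
  · refine Continuous.intervalIntegrable ?_ _ _
    exact (((contDiff_lineCutoff.continuous_deriv le_rfl).comp
      (continuous_id.div_const e)).div_const e).neg

theorem ae_snd_coord_ne_zero : ∀ᵐ z : EuclideanSpace ℝ (Fin 2), z 1 ≠ 0 := by
  rw [ae_iff]
  simp only [not_not]
  have := (PiLp.volume_preserving_ofLp (Fin 2)).measure_preimage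
    (s := univ.pi ![univ, {0}]) (MeasurableSet.univ_pi fun i => by
      fin_cases i <;> simp).nullMeasurableSet
  rw [volume_pi_pi, Fin.prod_univ_two] at this
  simp only [Matrix.cons_val_zero, Matrix.cons_val_one, Real.volume_singleton, mul_zero] at this
  convert this using 2
  ext z
  simp [Fin.forall_fin_two]

open Filter Topology in
/-- A nonnegative function vanishing below the horizontal axis and equal to `1` just above a set of
positive length in the axis has no weak vertical derivative. -/
theorem not_isWeakPartialDeriv_of_jump {u g : EuclideanSpace ℝ (Fin 2) → ℝ} {F : Set ℝ} {δ : ℝ}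
    (hδ : 0 < δ) (hFm : MeasurableSet F) (hF : volume F ≠ 0) (hF01 : F ⊆ Ioo 0 1)
    (hu0 : ∀ z, 0 ≤ u z) (hneg : ∀ z, z 1 ≤ 0 → u z = 0)
    (h1 : ∀ z, z 0 ∈ F → 0 < z 1 → z 1 < δ → u z = 1) :
    ¬ IsWeakPartialDeriv univ 1 u g := by
  rintro ⟨hu, hg, hw⟩
  rw [locallyIntegrableOn_univ] at hu hg
  simp only [Measure.restrict_univ] at hw
  have hFfin : volume F ≠ ∞ := ((measure_mono hF01).trans_lt measure_Ioo_lt_top).ne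
  -- Testing with a strip of height `e` moves the derivative to the cutoff. Above the axis the
  -- cutoff decreases, so `-u ∂φ` is nonnegative, and over `F` it contributes the full mass 1 per
  -- unit length.
  have hlow : ∀ e, 0 < e → 2 * e < δ → volume.real F ≤ ∫ z, stripCutoff e z * g z := by
    intro e he heδ
    have hφ := hw _ (contDiff_stripCutoff e) (hasCompactSupport_stripCutoff he) (subset_univ _)
    rw [eq_neg_iff_add_eq_zero, add_comm, ← eq_neg_iff_add_eq_zero, ← integral_neg] at hφ
    rw [hφ]
    have hprod := integral_plane_mul (F.indicator fun _ => 1)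
      ((Ioc 0 (2 * e)).indicator (fun y => -(deriv lineCutoff (y / e) / e)))
    rw [integral_deriv_lineCutoff he, mul_one, integral_indicator_const _ hFm, smul_eq_mul,
      mul_one] at hprod
    rw [← hprod]
    have hpt : ∀ z : EuclideanSpace ℝ (Fin 2), 0 < z 1 →
        0 ≤ -(deriv lineCutoff (z 1 / e) / e) := fun z hz =>
      neg_nonneg.2 (div_nonpos_of_nonpos_of_nonneg
        (deriv_lineCutoff_nonpos (by positivity)) he.le)
    refine integral_mono_of_nonneg (Eventually.of_forall fun z => ?_) ?_
      (Eventually.of_forall fun z => ?_)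
    · refine mul_nonneg (indicator_nonneg (fun _ _ => zero_le_one) _) ?_
      exact indicator_apply_nonneg fun h => hpt z h.1
    · refine Integrable.neg ?_
      have := hu.integrable_smul_left_of_hasCompactSupport
        (((contDiff_stripCutoff e).continuous_fderiv one_ne_zero).clm_apply
          (continuous_const (y := EuclideanSpace.single 1 1)))
        (((hasCompactSupport_stripCutoff he).fderiv ℝ).comp_left
          (g := fun L : EuclideanSpace ℝ (Fin 2) →L[ℝ] ℝ => L (EuclideanSpace.single 1 1)) rfl)
      refine this.congr (Eventually.of_forall fun z => ?_)
      simp only [smul_eq_mul]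
      exact mul_comm _ _
    · simp only [fderiv_stripCutoff]
      rcases le_or_gt (z 1) 0 with hz | hz
      · have h0 : z 1 ∉ Ioc 0 (2 * e) := fun h => h.1.not_ge hz
        rw [hneg z hz, indicator_of_notMem h0]
        simp
      by_cases hzF : z 0 ∈ F ∧ z 1 ∈ Ioc 0 (2 * e)
      · have h01 := hF01 hzF.1
        rw [indicator_of_mem hzF.1, indicator_of_mem hzF.2, h1 z hzF.1 hz
          (hzF.2.2.trans_lt heδ), lineCutoff_eq_one (abs_le.2 ⟨by linarith [h01.1], h01.2.le⟩)]
        simp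
      · have : F.indicator (fun _ => (1 : ℝ)) (z 0) *
            (Ioc 0 (2 * e)).indicator (fun y => -(deriv lineCutoff (y / e) / e)) (z 1) = 0 := by
          rw [not_and_or] at hzF
          rcases hzF with h | h
          · rw [indicator_of_notMem h, zero_mul]
          · rw [indicator_of_notMem h, mul_zero]
        rw [this]
        have := mul_nonneg (hu0 z) (mul_nonneg (lineCutoff_nonneg (z 0)) (hpt z hz))
        linarith
  set ε : ℕ → ℝ := fun n => δ / 4 * (1 / ((n : ℝ) + 1)) with hε
  have hn1 : ∀ n : ℕ, 1 / ((n : ℝ) + 1) ≤ 1 := fun n => by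
    rw [div_le_one (by positivity)]
    linarith [n.cast_nonneg (α := ℝ)]
  have hε0 : ∀ n, 0 < ε n := fun n => by positivity
  have hε1 : ∀ n, ε n ≤ δ / 4 := fun n => mul_le_of_le_one_right (by positivity) (hn1 n)
  have hεt : Tendsto ε atTop (𝓝 0) := by
    simpa only [mul_zero] using
      (tendsto_one_div_add_atTop_nhds_zero_nat (𝕜 := ℝ)).const_mul (δ / 4)
  -- The strips shrink to the axis, a null set, while `g` is integrable on a fixed box containing
  -- them all. So the integrals vanish in the limit, against the lower bound `hlow`.
  have hlim : Tendsto (fun n => ∫ z, stripCutoff (ε n) z * g z) atTop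
      (𝓝 (∫ _ : EuclideanSpace ℝ (Fin 2), (0 : ℝ))) := by
    set B := {z : EuclideanSpace ℝ (Fin 2) | z 0 ∈ Icc (-2) 2 ∧ z 1 ∈ Icc (-δ) δ}
    have hB : IsCompact B := isCompact_plane_box _ _ _ _
    refine tendsto_integral_of_dominated_convergence (B.indicator fun z => ‖g z‖)
      (fun n => ?_) ?_ (fun n => Eventually.of_forall fun z => ?_) ?_
    · exact (contDiff_stripCutoff _).continuous.aestronglyMeasurable.mul hg.aestronglyMeasurable
    · exact (integrable_indicator_iff hB.measurableSet).2 (hg.integrableOn_isCompact hB).norm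
    · by_cases hz : z ∈ B
      · rw [indicator_of_mem hz, norm_mul]
        refine mul_le_of_le_one_left (norm_nonneg _) ?_
        rw [stripCutoff, Real.norm_of_nonneg (mul_nonneg (lineCutoff_nonneg _) (lineCutoff_nonneg _))]
        exact mul_le_one₀ (lineCutoff_le_one _) (lineCutoff_nonneg _) (lineCutoff_le_one _)
      · rw [indicator_of_notMem hz, stripCutoff_eq_zero (hε0 n), zero_mul, norm_zero]
        exact fun h => hz ⟨h.1, by linarith [h.2.1, hε1 n], by linarith [h.2.2, hε1 n]⟩
    · filter_upwards [ae_snd_coord_ne_zero] with z hz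
      refine tendsto_const_nhds.congr' ?_
      have : ∀ᶠ n in atTop, ε n < |z 1| / 2 := hεt.eventually_lt_const (by positivity)
      filter_upwards [this] with n hn
      rw [stripCutoff, lineCutoff_eq_zero (s := z 1 / ε n), mul_zero, zero_mul]
      rw [abs_div, abs_of_pos (hε0 n), le_div_iff₀ (hε0 n)]
      linarith
  rw [integral_zero] at hlim
  have := ge_of_tendsto' hlim fun n => hlow (ε n) (hε0 n) (by linarith [hε1 n])
  exact hF ((measureReal_eq_zero_iff hFfin).1 (le_antisymm this measureReal_nonneg))

/-! ### The infimum of a family above the axis -/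

/-- The infimum of a family of functions in the open upper half-plane, extended by `0`. -/
noncomputable def upperInf {κ : Type*} (V : κ → EuclideanSpace ℝ (Fin 2) → ℝ)
    (z : EuclideanSpace ℝ (Fin 2)) : ℝ :=
  if 0 < z 1 then ⨅ k, V k z else 0

section UpperInf

variable {κ : Type*} {V : Option κ → EuclideanSpace ℝ (Fin 2) → ℝ}

theorem upperInf_nonneg (h0 : ∀ o z, 0 ≤ V o z) (z : EuclideanSpace ℝ (Fin 2)) :
    0 ≤ upperInf V z := by
  unfold upperInf
  split_ifs
  · exact Real.iInf_nonneg fun o => h0 o z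
  · exact le_rfl

theorem upperInf_le (h0 : ∀ o z, 0 ≤ V o z) (o : Option κ) (z : EuclideanSpace ℝ (Fin 2)) :
    upperInf V z ≤ V o z := by
  unfold upperInf
  split_ifs
  · exact ciInf_le ⟨0, by rintro _ ⟨o, rfl⟩; exact h0 o z⟩ o
  · exact h0 o z

theorem upperInf_of_nonpos {z : EuclideanSpace ℝ (Fin 2)} (hz : z 1 ≤ 0) : upperInf V z = 0 :=
  if_neg hz.not_gt

theorem upperInf_eq_zero (h0 : ∀ o z, 0 ≤ V o z) {o : Option κ} {z : EuclideanSpace ℝ (Fin 2)}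
    (h : V o z = 0) : upperInf V z = 0 :=
  le_antisymm (h ▸ upperInf_le h0 o z) (upperInf_nonneg h0 z)

theorem continuous_coord {n : ℕ} (i : Fin n) :
    Continuous fun z : EuclideanSpace ℝ (Fin n) => z i := (contDiff_coord i).continuous

theorem isOpen_lt_snd (s : ℝ) : IsOpen {z : EuclideanSpace ℝ (Fin 2) | s < z 1} :=
  isOpen_lt continuous_const (continuous_coord 1)

/-- Above any positive height only finitely many members differ from 1, so the family has a common
Lipschitz constant there. At an axis point off `K`, a member vanishing nearby forces the infimum to
vanish on both sides. -/
theorem locallyLipschitzOn_upperInf {K : Set (EuclideanSpace ℝ (Fin 2))}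
    (h0 : ∀ o z, 0 ≤ V o z) (hL : ∀ o, ∃ C, LipschitzWith C (V o))
    (hfin : ∀ s : ℝ, 0 < s → {k : κ | ∃ z, s < z 1 ∧ V (some k) z ≠ 1}.Finite)
    (hzero : ∀ z ∉ K, z 1 = 0 → ∃ o, ∀ᶠ w in nhds z, V o w = 0) :
    LocallyLipschitzOn Kᶜ (upperInf V) := by
  choose C hC using hL
  intro z hz
  suffices ∃ D, ∃ t ∈ nhds z, LipschitzOnWith D (upperInf V) t by
    obtain ⟨D, t, ht, h⟩ := this
    exact ⟨D, t, mem_nhdsWithin_of_mem_nhds ht, h⟩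
  have hconst : ∀ t : Set (EuclideanSpace ℝ (Fin 2)), (∀ w ∈ t, upperInf V w = 0) →
      LipschitzOnWith 0 (upperInf V) t := fun t ht =>
    LipschitzOnWith.of_dist_le_mul fun x hx y hy => by simp [ht x hx, ht y hy]
  rcases lt_trichotomy (z 1) 0 with h | h | h
  · refine ⟨0, {w | w 1 < 0}, (isOpen_lt (continuous_coord 1) continuous_const).mem_nhds h,
      hconst _ fun w hw => upperInf_of_nonpos (le_of_lt hw)⟩
  · obtain ⟨o, ho⟩ := hzero z hz h
    exact ⟨0, _, ho, hconst _ fun w hw => upperInf_eq_zero h0 hw⟩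
  · have hs : 0 < z 1 / 2 := by positivity
    set T := (hfin _ hs).toFinset
    set D := max (C none) (T.sup fun k => C (some k))
    refine ⟨D, {w | z 1 / 2 < w 1}, (isOpen_lt_snd _).mem_nhds (half_lt_self h), ?_⟩
    have hD : ∀ o, LipschitzOnWith D (V o) {w | z 1 / 2 < w 1} := by
      rintro (_ | k)
      · exact ((hC none).weaken (le_max_left _ _)).lipschitzOnWith
      · by_cases hk : k ∈ T
        · exact ((hC (some k)).weaken
            ((Finset.le_sup (f := fun k => C (some k)) hk).trans (le_max_right _ _))).lipschitzOnWith
        · have h1 : ∀ w : EuclideanSpace ℝ (Fin 2), z 1 / 2 < w 1 → V (some k) w = 1 := by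
            intro w hw
            by_contra hne
            exact hk ((hfin _ hs).mem_toFinset.2 ⟨w, hw, hne⟩)
          refine LipschitzOnWith.of_dist_le_mul fun x hx y hy => ?_
          rw [h1 x hx, h1 y hy, dist_self]
          positivity
    refine LipschitzOnWith.of_le_add_mul D fun x hx y hy => ?_
    have hy0 : 0 < y 1 := hs.trans hy
    rw [← sub_le_iff_le_add, upperInf, upperInf, if_pos hy0, if_pos (hs.trans hx)]
    refine le_ciInf fun o => sub_le_iff_le_add.2 ?_
    refine (ciInf_le ⟨0, by rintro _ ⟨o, rfl⟩; exact h0 o x⟩ o).trans ?_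
    have := (hD o).dist_le_mul x hx y hy
    rw [Real.dist_eq] at this
    linarith [le_abs_self (V o x - V o y)]

/-- All but finitely many members equal 1 at `z`, hence are not below `V none z`; the minimum over
the rest together with `none` is the infimum. -/
theorem exists_upperInf_eq (h0 : ∀ o z, 0 ≤ V o z) (h1 : ∀ z, V none z ≤ 1)
    (hfin : ∀ s : ℝ, 0 < s → {k : κ | ∃ z, s < z 1 ∧ V (some k) z ≠ 1}.Finite)
    {z : EuclideanSpace ℝ (Fin 2)} (hz : 0 < z 1) : ∃ o, upperInf V z = V o z := by
  classical
  have hs : 0 < z 1 / 2 := by positivity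
  set T := (hfin _ hs).toFinset
  obtain ⟨o, -, ho⟩ := Finset.exists_min_image (insert none (T.image some)) (fun o => V o z)
    (Finset.insert_nonempty _ _)
  refine ⟨o, le_antisymm (upperInf_le h0 o z) ?_⟩
  rw [upperInf, if_pos hz]
  refine le_ciInf fun o' => ?_
  have hnone := ho none (Finset.mem_insert_self _ _)
  rcases o' with _ | k
  · exact hnone
  · by_cases hk : k ∈ T
    · exact ho _ (Finset.mem_insert_of_mem (Finset.mem_image_of_mem _ hk))
    · have : V (some k) z = 1 := by
        by_contra hne
        exact hk ((hfin _ hs).mem_toFinset.2 ⟨z, half_lt_self hz, hne⟩)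
      rw [this]
      exact hnone.trans (h1 z)

/-- If `V o` attains the infimum at `z`, then `V o - upperInf V` is minimal there, so the two
derivatives agree and a single term of the sum bounds the integrand. Countability gives almost
everywhere differentiability of all members at once. -/
theorem lintegral_fderiv_upperInf_le [Countable κ]
    (h0 : ∀ o z, 0 ≤ V o z) (h1 : ∀ z, V none z ≤ 1) (hL : ∀ o, ∃ C, LipschitzWith C (V o))
    (hfin : ∀ s : ℝ, 0 < s → {k : κ | ∃ z, s < z 1 ∧ V (some k) z ≠ 1}.Finite)
    {Psi : ℝ → ℝ} (hPsi0 : Psi 0 = 0) (hPsi : Measurable Psi) (v : EuclideanSpace ℝ (Fin 2)) :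
    ∫⁻ z, ENNReal.ofReal (Psi |fderiv ℝ (upperInf V) z v|) ≤
      ∑' o, ∫⁻ z, ENNReal.ofReal (Psi |fderiv ℝ (V o) z v|) := by
  have hm : ∀ o, Measurable fun z => ENNReal.ofReal (Psi |fderiv ℝ (V o) z v|) := fun o =>
    (hPsi.comp (measurable_fderiv_apply_const ℝ (V o) v).abs).ennreal_ofReal
  rw [← lintegral_tsum fun o => (hm o).aemeasurable]
  refine lintegral_mono_ae ?_
  have hd : ∀ᵐ z, ∀ o, DifferentiableAt ℝ (V o) z := ae_all_iff.2 fun o => by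
    obtain ⟨C, hC⟩ := hL o
    exact hC.ae_differentiableAt
  filter_upwards [hd, ae_snd_coord_ne_zero] with z hz hz0
  rcases lt_or_gt_of_ne hz0 with h | h
  · have : upperInf V =ᶠ[nhds z] fun _ => 0 := by
      filter_upwards [(isOpen_lt (continuous_coord 1) continuous_const).mem_nhds h] with w hw
      exact upperInf_of_nonpos (le_of_lt hw)
    rw [this.fderiv_eq]
    simp [hPsi0]
  by_cases hu : DifferentiableAt ℝ (upperInf V) z
  · obtain ⟨o, ho⟩ := exists_upperInf_eq h0 h1 hfin h
    have hmin : IsLocalMin (fun w => V o w - upperInf V w) z :=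
      Filter.Eventually.of_forall fun w => by
        simp only [ho, sub_self]
        exact sub_nonneg.2 (upperInf_le h0 o w)
    have := hmin.fderiv_eq_zero
    rw [fderiv_fun_sub (hz o) hu, sub_eq_zero] at this
    rw [← this]
    exact ENNReal.le_tsum (f := fun o => ENNReal.ofReal (Psi |fderiv ℝ (V o) z v|)) o
  -- At points of non-differentiability `fderiv` takes the default value 0, so the integrand is `Psi
  -- 0 = 0`.
  · rw [fderiv_zero_of_not_differentiableAt hu]
    simp [hPsi0]

end UpperInf

/-! ### Basic properties of the Orlicz function -/

theorem orliczFun_nonneg {p lam t : ℝ} (ht : 0 ≤ t) : 0 ≤ orliczFun p lam t :=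
  mul_nonneg (Real.rpow_nonneg ht _) (Real.rpow_nonneg (Real.log_nonneg (by
    linarith [Real.add_one_le_exp (1 : ℝ)])) _)

theorem orliczFun_zero {p lam : ℝ} (hp : p ≠ 0) : orliczFun p lam 0 = 0 := by
  rw [orliczFun, Real.zero_rpow hp, zero_mul]

theorem measurable_orliczFun (p lam : ℝ) : Measurable (orliczFun p lam) := by
  unfold orliczFun
  fun_prop

theorem continuousOn_orliczFun {p lam : ℝ} (hp : 0 ≤ p) :
    ContinuousOn (orliczFun p lam) (Ici 0) := by
  have h1 : ∀ t ∈ Ici (0 : ℝ), 1 < Real.exp 1 + t := fun t ht => by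
    linarith [Real.add_one_le_exp (1 : ℝ), mem_Ici.1 ht]
  refine (continuousOn_id.rpow_const fun t _ => Or.inr hp).mul
    (ContinuousOn.rpow_const (ContinuousOn.log (by fun_prop) fun t ht => ?_) fun t ht => Or.inl ?_)
  · linarith [h1 t ht]
  · exact (Real.log_pos (h1 t ht)).ne'

/-- Bounded functions with compact support have finite Orlicz integral. -/
theorem lintegral_orliczFun_lt_top {n : ℕ} {p lam : ℝ} (hp : 0 < p)
    {B : Set (EuclideanSpace ℝ (Fin n))} (hB : IsCompact B) {h : EuclideanSpace ℝ (Fin n) → ℝ}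
    {A : ℝ} (hA : ∀ z, |h z| ≤ A) (h0 : ∀ z ∉ B, h z = 0) :
    ∫⁻ z, ENNReal.ofReal (orliczFun p lam |h z|) < ∞ := by
  obtain ⟨M, hM⟩ := (isCompact_Icc (a := (0 : ℝ)) (b := A)).exists_bound_of_continuousOn
    ((continuousOn_orliczFun (lam := lam) hp.le).mono Icc_subset_Ici_self)
  calc ∫⁻ z, ENNReal.ofReal (orliczFun p lam |h z|)
      ≤ ∫⁻ z, B.indicator (fun _ => ENNReal.ofReal M) z := lintegral_mono fun z => by
        by_cases hz : z ∈ B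
        · rw [indicator_of_mem hz]
          exact ENNReal.ofReal_le_ofReal ((Real.le_norm_self _).trans
            (hM _ ⟨abs_nonneg _, hA z⟩))
        · simp [h0 z hz, orliczFun_zero hp.ne']
    _ = ENNReal.ofReal M * volume B := lintegral_indicator_const hB.measurableSet _
    _ < ∞ := ENNReal.mul_lt_top ENNReal.ofReal_lt_top hB.measure_lt_top

/-! ### Capacity profiles and the cutoff for finitely many gaps -/

/-- The point of the horizontal axis with abscissa `x`. -/
noncomputable def axisPoint (x : ℝ) : EuclideanSpace ℝ (Fin 2) := !₂[x, 0]

@[simp] theorem axisPoint_zero (x : ℝ) : axisPoint x 0 = x := rfl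

@[simp] theorem axisPoint_one (x : ℝ) : axisPoint x 1 = 0 := rfl

theorem abs_coord_sub_le_dist {n : ℕ} (i : Fin n) (z w : EuclideanSpace ℝ (Fin n)) :
    |z i - w i| ≤ dist z w := by
  rw [dist_eq_norm, ← Real.norm_eq_abs]
  exact PiLp.norm_apply_le (z - w) i

theorem dist_axisPoint_of_snd_eq_zero {z : EuclideanSpace ℝ (Fin 2)} (hz : z 1 = 0) (x : ℝ) :
    dist z (axisPoint x) = |z 0 - x| := by
  rw [EuclideanSpace.dist_eq, Fin.sum_univ_two]
  simp [hz, Real.dist_eq, Real.sqrt_sq_eq_abs]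

/-- `v` is a Lipschitz function vanishing on the disk of radius `r` about `c`, equal to `1` off the
disk of radius `R`, whose partial derivatives have `Ψ`-integral at most `e`. -/
structure IsCapacityProfile (Psi : ℝ → ℝ) (c : EuclideanSpace ℝ (Fin 2)) (r R e : ℝ)
    (v : EuclideanSpace ℝ (Fin 2) → ℝ) : Prop where
  lipschitz : ∃ C, LipschitzWith C v
  nonneg : ∀ z, 0 ≤ v z
  eq_zero : ∀ z, dist z c ≤ r → v z = 0
  eq_one : ∀ z, R ≤ dist z c → v z = 1
  energy_le : ∀ i : Fin 2, ∫⁻ z, ENNReal.ofReal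
    (Psi |fderiv ℝ v z (EuclideanSpace.single i 1)|) ≤ ENNReal.ofReal e

/-- The cutoff around the unit segment in the plane that vanishes over the closed set `N`. -/
noncomputable def gapCutoff (N : Set ℝ) (δ : ℝ) (z : EuclideanSpace ℝ (Fin 2)) : ℝ :=
  min (min (Metric.infDist (z 0) N / δ) (max (2 - |z 1|) 0)) 1

theorem gapCutoff_nonneg {N : Set ℝ} {δ : ℝ} (hδ : 0 < δ) (z : EuclideanSpace ℝ (Fin 2)) :
    0 ≤ gapCutoff N δ z :=
  le_min (le_min (div_nonneg Metric.infDist_nonneg hδ.le) (le_max_right _ _)) zero_le_one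

theorem gapCutoff_eq_zero_of_mem {N : Set ℝ} {δ : ℝ} {z : EuclideanSpace ℝ (Fin 2)}
    (hz : z 0 ∈ N) : gapCutoff N δ z = 0 := by
  rw [gapCutoff, Metric.infDist_zero_of_mem hz, zero_div, min_eq_left (le_max_right _ _),
    min_eq_left zero_le_one]

theorem gapCutoff_eq_zero_of_two_le {N : Set ℝ} {δ : ℝ} (hδ : 0 < δ)
    {z : EuclideanSpace ℝ (Fin 2)} (hz : 2 ≤ |z 1|) : gapCutoff N δ z = 0 := by
  rw [gapCutoff, max_eq_right (by linarith),
    min_eq_right (div_nonneg Metric.infDist_nonneg hδ.le), min_eq_left zero_le_one]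

theorem gapCutoff_eq_one {N : Set ℝ} {δ : ℝ} (hδ : 0 < δ) {z : EuclideanSpace ℝ (Fin 2)}
    (hz : δ ≤ Metric.infDist (z 0) N) (hz1 : |z 1| ≤ 1) : gapCutoff N δ z = 1 :=
  min_eq_right (le_min ((one_le_div hδ).2 hz) (le_max_of_le_left (by linarith)))

theorem exists_lipschitzWith_gapCutoff (N : Set ℝ) (δ : ℝ) :
    ∃ C, LipschitzWith C (gapCutoff N δ) := by
  have hc : ∀ i : Fin 2, LipschitzWith 1 fun z : EuclideanSpace ℝ (Fin 2) => z i := fun i =>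
    LipschitzWith.of_dist_le_mul fun z w => by
      rw [NNReal.coe_one, one_mul, Real.dist_eq]
      exact abs_coord_sub_le_dist i z w
  have h1 := (Metric.lipschitz_infDist_pt N).comp (hc 0)
  have h2 : LipschitzWith ‖(1 / δ : ℝ)‖₊ fun t : ℝ => t / δ := LipschitzWith.of_dist_le_mul
    fun s t => by
      rw [Real.dist_eq, Real.dist_eq, ← sub_div, div_eq_mul_one_div, abs_mul, mul_comm]
      rfl
  have h3 : LipschitzWith 1 fun t : ℝ => 2 - |t| := LipschitzWith.of_dist_le_mul fun s t => by
    rw [Real.dist_eq, Real.dist_eq, NNReal.coe_one, one_mul, abs_sub_comm]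
    simpa using abs_abs_sub_abs_le s t
  exact ⟨_, ((h2.comp h1).min ((h3.comp (hc 1)).max_const 0)).min_const 1⟩

theorem lintegral_fderiv_gapCutoff_lt_top {p lam : ℝ} (hp : 0 < p) {N : Set ℝ} {δ : ℝ}
    (hδ : 0 < δ) (hN : ∀ x, x ∉ N → x ∈ Icc (0 : ℝ) 1) (v : EuclideanSpace ℝ (Fin 2)) :
    ∫⁻ z, ENNReal.ofReal (orliczFun p lam |fderiv ℝ (gapCutoff N δ) z v|) < ∞ := by
  obtain ⟨C, hC⟩ := exists_lipschitzWith_gapCutoff N δ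
  have hB := isCompact_plane_box 0 1 (-2) 2
  refine lintegral_orliczFun_lt_top hp hB (A := C * ‖v‖) (fun z => ?_) fun z hz => ?_
  · exact ((fderiv ℝ (gapCutoff N δ) z).le_opNorm v).trans (mul_le_mul_of_nonneg_right
      (norm_fderiv_le_of_lipschitz ℝ hC) (norm_nonneg _))
  · have : gapCutoff N δ =ᶠ[nhds z] fun _ => 0 := by
      filter_upwards [hB.isClosed.isOpen_compl.mem_nhds hz] with w hw
      by_contra hne
      refine hw ⟨hN _ fun h => hne (gapCutoff_eq_zero_of_mem h), ?_⟩
      refine abs_le.1 (not_lt.1 fun h => hne (gapCutoff_eq_zero_of_two_le hδ h.le))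
    rw [this.fderiv_eq]
    simp

theorem isClosed_lineInPlane {E : Set ℝ} (hE : IsClosed E) : IsClosed (lineInPlane E) :=
  (hE.preimage (continuous_coord 0)).inter (isClosed_eq (continuous_coord 1) continuous_const)

/-! ### The criterion for non-removability -/

open Filter Topology in
/-- A compact subset of the unit interval of positive length is not removable as soon as all but
finitely many of its gaps carry capacity profiles of summable radii and energies. -/
theorem not_isPLRemovable_of_isCapacityProfile {ι : Type*} [Countable ι] {p lam : ℝ} (hp : 0 < p)
    {E : Set ℝ} {a b : ι → ℝ} (hE : IsCompact E) (hE01 : E ⊆ Ioo 0 1)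
    (hunion : Ioo 0 1 \ E = ⋃ j, Ioo (a j) (b j)) (hvol : volume E ≠ 0)
    {ρ e : ι → ℝ} (hρ : Summable ρ) (he : Summable e)
    (hv : ∀ᶠ j in cofinite, ∃ v, IsCapacityProfile (orliczFun p lam) (axisPoint ((a j + b j) / 2))
      ((b j - a j) / 2) (ρ j) (e j) v) :
    ¬ IsPLRemovable p lam E := by
  have hgapE : ∀ j, ∀ x ∈ Ioo (a j) (b j), x ∉ E := fun j x hx =>
    (hunion.symm.subset (mem_iUnion.2 ⟨j, hx⟩)).2
  have hfinρ : ∑' j, volume (Icc ((a j + b j) / 2 - ρ j) ((a j + b j) / 2 + ρ j)) ≠ ∞ := by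
    have : ∀ j, volume (Icc ((a j + b j) / 2 - ρ j) ((a j + b j) / 2 + ρ j)) =
        ENNReal.ofReal (2 * ρ j) := fun j => by rw [Real.volume_Icc]; ring_nf
    simp_rw [this]
    exact (hρ.mul_left 2).tsum_ofReal_ne_top
  -- `S` is a finite set of gaps that contains all those without a profile and leaves a tail whose
  -- disks cover less than the length of `E`.
  obtain ⟨S, hStail, hSv⟩ := (((ENNReal.tendsto_tsum_compl_atTop_zero hfinρ).eventually_lt_const
    (pos_iff_ne_zero.2 hvol)).and (eventually_ge_atTop (α := Finset ι)
      (Set.Finite.toFinset (eventually_cofinite.1 hv)))).exists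
  have hv' : ∀ j ∉ S, ∃ v, IsCapacityProfile (orliczFun p lam) (axisPoint ((a j + b j) / 2))
      ((b j - a j) / 2) (ρ j) (e j) v := fun j hj => by
    by_contra h
    exact hj (hSv ((Set.Finite.mem_toFinset _).2 h))
  choose v hv using fun j : {j // j ∉ S} => hv' j j.2
  have hne : E.Nonempty := nonempty_of_measure_ne_zero hvol
  obtain ⟨m, hmE, hm⟩ := hE.exists_isLeast hne
  obtain ⟨M, hME, hM⟩ := hE.exists_isGreatest hne
  have hm0 := (hE01 hmE).1
  have hM1 := (hE01 hME).2
  -- The cutoff must vanish over the gaps in `S` and beyond the ends of `E`. The thresholds lie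
  -- midway between 0 and `min E`, and between `max E` and 1, so `N` meets `E` only in endpoints of
  -- finitely many gaps.
  set N : Set ℝ := (⋃ j ∈ S, Icc (a j) (b j)) ∪ (Iic (m / 2) ∪ Ici ((1 + M) / 2)) with hNdef
  have hNcl : IsClosed N := (S.finite_toSet.isClosed_biUnion fun _ _ => isClosed_Icc).union
    (isClosed_Iic.union isClosed_Ici)
  have hNne : N.Nonempty := ⟨m / 2, Or.inr (Or.inl (mem_Iic.2 le_rfl))⟩
  have hEN : volume (E \ N) = volume E := by
    refine measure_sdiff_null' ?_
    refine measure_mono_null (t := ⋃ j ∈ S, {a j, b j}) ?_ ?_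
    · rintro x ⟨hxE, hx | hx | hx⟩
      · obtain ⟨j, hj, hx⟩ := mem_iUnion₂.1 hx
        refine mem_iUnion₂.2 ⟨j, hj, ?_⟩
        by_contra hne
        simp only [mem_insert_iff, mem_singleton_iff, not_or] at hne
        exact hgapE j x ⟨lt_of_le_of_ne hx.1 (Ne.symm hne.1), lt_of_le_of_ne hx.2 hne.2⟩ hxE
      · linarith [hm hxE, mem_Iic.1 hx]
      · linarith [hM hxE, mem_Ici.1 hx]
    · exact (S.finite_toSet.biUnion fun j _ => (Set.toFinite {a j, b j})).measure_zero _
  set F : ℕ → Set ℝ := fun n => {x ∈ E | 1 / ((n : ℝ) + 1) ≤ Metric.infDist x N} with hF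
  have hFcl : ∀ n, IsClosed (F n) := fun n => hE.isClosed.inter
    (isClosed_le continuous_const (Metric.continuous_infDist_pt N))
  have hFmono : Monotone F := fun n n' h x hx => ⟨hx.1, le_trans (by gcongr) hx.2⟩
  have hFU : E \ N ⊆ ⋃ n, F n := fun x hx => by
    have hpos := (hNcl.notMem_iff_infDist_pos hNne).1 hx.2
    obtain ⟨n, hn⟩ := exists_nat_one_div_lt hpos
    exact mem_iUnion.2 ⟨n, hx.1, hn.le⟩
  obtain ⟨n, hn⟩ : ∃ n, ∑' j : {j // j ∉ S},
      volume (Icc ((a j + b j) / 2 - ρ j) ((a j + b j) / 2 + ρ j)) < volume (F n) := by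
    rw [← lt_iSup_iff, ← hFmono.measure_iUnion]
    exact hStail.trans_le (hEN ▸ measure_mono hFU)
  set δ : ℝ := 1 / ((n : ℝ) + 1)
  have hδ : 0 < δ := by positivity
  set G : Set ℝ := F n \ ⋃ j : {j // j ∉ S},
    Icc ((a j + b j) / 2 - ρ j) ((a j + b j) / 2 + ρ j) with hG
  have hGm : MeasurableSet G :=
    (hFcl n).measurableSet.diff (MeasurableSet.iUnion fun _ => measurableSet_Icc)
  have hGvol : volume G ≠ 0 := fun h0 => by
    have h1 := (measure_mono (μ := volume) (subset_sdiff_union (F n) (⋃ j : {j // j ∉ S},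
      Icc ((a j + b j) / 2 - ρ j) ((a j + b j) / 2 + ρ j)))).trans (measure_union_le _ _)
    rw [← hG, h0, zero_add] at h1
    exact hn.not_ge (h1.trans (measure_iUnion_le _))
  set V : Option {j // j ∉ S} → EuclideanSpace ℝ (Fin 2) → ℝ := fun o =>
    o.elim (gapCutoff N δ) v with hV
  have hV0 : ∀ o z, 0 ≤ V o z := by
    rintro (_ | j) z
    · exact gapCutoff_nonneg hδ z
    · exact (hv j).nonneg z
  have hVL : ∀ o, ∃ C, LipschitzWith C (V o) := by
    rintro (_ | j)
    · exact exists_lipschitzWith_gapCutoff N δ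
    · exact (hv j).lipschitz
  have hV1 : ∀ z, V none z ≤ 1 := fun z => min_le_right _ _
  have hfin : ∀ s : ℝ, 0 < s →
      {k : {j // j ∉ S} | ∃ z : EuclideanSpace ℝ (Fin 2), s < z 1 ∧ V (some k) z ≠ 1}.Finite := by
    intro s hs
    have h1 := hρ.tendsto_cofinite_zero.eventually_lt_const hs
    refine ((eventually_cofinite.1 h1).preimage
      (Subtype.val_injective (p := fun j => j ∉ S)).injOn).subset ?_
    rintro k ⟨z, hz, hne⟩ hlt
    refine hne ((hv k).eq_one z ?_)
    have := abs_coord_sub_le_dist 1 z (axisPoint ((a k + b k) / 2))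
    rw [axisPoint_one, sub_zero] at this
    linarith [le_abs_self (z 1)]
  -- Off `E`, a gap in `S` and the exterior of the unit interval are handled by the cutoff, any
  -- other gap by its own profile.
  have hzero : ∀ z ∉ lineInPlane E, z 1 = 0 → ∃ o, ∀ᶠ w in nhds z, V o w = 0 := by
    intro z hz hz1
    have hzE : z 0 ∉ E := fun h => hz ⟨h, hz1⟩
    by_cases h01 : z 0 ∈ Ioo (0 : ℝ) 1
    · obtain ⟨j, hj⟩ := mem_iUnion.1 (hunion.subset ⟨h01, hzE⟩)
      by_cases hjS : j ∈ S
      · refine ⟨none, ?_⟩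
        filter_upwards [(isOpen_Ioo.preimage (continuous_coord 0)).mem_nhds hj] with w hw
        exact gapCutoff_eq_zero_of_mem (Or.inl (mem_iUnion₂.2 ⟨j, hjS, Ioo_subset_Icc_self hw⟩))
      · refine ⟨some ⟨j, hjS⟩, ?_⟩
        have : z ∈ Metric.ball (axisPoint ((a j + b j) / 2)) ((b j - a j) / 2) := by
          rw [Metric.mem_ball, dist_axisPoint_of_snd_eq_zero hz1, abs_lt]
          constructor <;> linarith [hj.1, hj.2]
        filter_upwards [Metric.isOpen_ball.mem_nhds this] with w hw
        exact (hv ⟨j, hjS⟩).eq_zero w (le_of_lt hw)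
    · refine ⟨none, ?_⟩
      rw [mem_Ioo, not_and_or, not_lt, not_lt] at h01
      rcases h01 with h | h
      · filter_upwards [((isOpen_Iio (a := m / 2)).preimage (continuous_coord 0)).mem_nhds
          (show z 0 < m / 2 by linarith)] with w hw
        exact gapCutoff_eq_zero_of_mem (Or.inr (Or.inl (mem_Iic.2 (le_of_lt hw))))
      · filter_upwards [((isOpen_Ioi (a := (1 + M) / 2)).preimage (continuous_coord 0)).mem_nhds
          (show (1 + M) / 2 < z 0 by linarith)] with w hw
        exact gapCutoff_eq_zero_of_mem (Or.inr (Or.inr (mem_Ici.2 (le_of_lt hw))))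
  have hN01 : ∀ x, x ∉ N → x ∈ Icc (0 : ℝ) 1 := by
    intro x hx
    simp only [hNdef, mem_union, not_or, mem_Iic, mem_Ici, not_le] at hx
    exact ⟨by linarith [hx.2.1], by linarith [hx.2.2]⟩
  have hΩ := (isClosed_lineInPlane hE.isClosed).isOpen_compl
  have hloc := locallyLipschitzOn_upperInf hV0 hVL hfin hzero
  have hmem : upperInf V ∈ orliczSobolev (orliczFun p lam) (lineInPlane E)ᶜ := by
    refine ⟨⟨hloc.continuousOn.aemeasurable hΩ.measurableSet, 1, one_pos, ?_⟩, fun i => ⟨_,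
      ⟨(measurable_fderiv_apply_const ℝ (upperInf V) _).aemeasurable, 1, one_pos, ?_⟩,
      hloc.isWeakPartialDeriv_fderiv hΩ i⟩⟩
    · simp only [one_mul]
      refine (setLIntegral_le_lintegral _ _).trans_lt (lintegral_orliczFun_lt_top hp
        (isCompact_plane_box 0 1 (-2) 2) (A := 1) (fun z => ?_) fun z hz => ?_)
      · rw [abs_of_nonneg (upperInf_nonneg hV0 z)]
        exact (upperInf_le hV0 none z).trans (hV1 z)
      · refine upperInf_eq_zero hV0 (o := none) ?_
        by_contra hne
        refine hz ⟨hN01 _ fun h => hne (gapCutoff_eq_zero_of_mem h), ?_⟩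
        exact abs_le.1 (not_lt.1 fun h => hne (gapCutoff_eq_zero_of_two_le hδ h.le))
    · simp only [one_mul]
      refine (setLIntegral_le_lintegral _ _).trans_lt ((lintegral_fderiv_upperInf_le hV0 hV1 hVL
        hfin (orliczFun_zero hp.ne') (measurable_orliczFun p lam) _).trans_lt ?_)
      rw [← (Equiv.optionEquivSumPUnit.{0} {j // j ∉ S}).symm.tsum_eq,
        ENNReal.summable.tsum_sum ENNReal.summable]
      refine ENNReal.add_lt_top.2 ⟨?_, ?_⟩
      · refine (ENNReal.tsum_le_tsum fun j => (hv j).energy_le i).trans_lt ?_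
        exact (he.subtype {j | j ∉ S}).tsum_ofReal_lt_top
      · simp only [tsum_fintype, Finset.univ_unique, Finset.sum_singleton]
        exact lintegral_fderiv_gapCutoff_lt_top hp hδ hN01 _
  intro hrem
  have hmem' : upperInf V ∈ orliczSobolev (orliczFun p lam) univ := hrem ▸ hmem
  obtain ⟨g, -, hg⟩ := hmem'.2 1
  refine not_isWeakPartialDeriv_of_jump one_pos hGm hGvol (fun x hx => hE01 hx.1.1)
    (upperInf_nonneg hV0) (fun z hz => upperInf_of_nonpos hz) (fun z hz hz0 hz1 => ?_) hg
  rw [upperInf, if_pos hz0]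
  have : ∀ o, V o z = 1 := by
    rintro (_ | j)
    · exact gapCutoff_eq_one hδ hz.1.2 (abs_le.2 ⟨by linarith, hz1.le⟩)
    · refine (hv j).eq_one z ((not_lt.1 fun hlt => hz.2 (mem_iUnion.2 ⟨j, ?_⟩)).trans
        (abs_coord_sub_le_dist 0 z _))
      rw [axisPoint_zero] at hlt
      exact ⟨by linarith [(abs_lt.1 hlt).1], by linarith [(abs_lt.1 hlt).2]⟩
  simp [this]

/-! ### Radial capacity profiles -/

/-- Integration of a radial function over an annulus in the plane. -/
theorem lintegral_annulus_radial {r R : ℝ} (hr : 0 < r) {q : ℝ → ℝ}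
    (hq : ContinuousOn q (Icc r R)) (hq0 : ∀ s ∈ Ioo r R, 0 ≤ q s) (c : EuclideanSpace ℝ (Fin 2)) :
    ∫⁻ z, ENNReal.ofReal ((Ioo r R).indicator q (dist z c)) =
      ENNReal.ofReal (2 * Real.pi * ∫ s in Ioo r R, s * q s) := by
  set Q := (Ioo r R).indicator q
  have hcomp : (fun y : ℝ => y ^ (Module.finrank ℝ (EuclideanSpace ℝ (Fin 2)) - 1) • Q y) =
      (Ioo r R).indicator fun s => s * q s := by
    funext y
    rw [finrank_euclideanSpace_fin]
    by_cases hy : y ∈ Ioo r R <;> simp [Q, hy]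
  have hsub : Ioo r R ∩ Ioi 0 = Ioo r R := inter_eq_left.2 fun y hy => hr.trans hy.1
  have hint : IntegrableOn (fun s => s * q s) (Ioo r R) :=
    ((continuousOn_id.mul hq).integrableOn_Icc).mono_set Ioo_subset_Icc_self
  have hQi : Integrable fun z : EuclideanSpace ℝ (Fin 2) => Q ‖z‖ := by
    rw [integrable_fun_norm_addHaar, hcomp]
    exact (hint.integrable_indicator measurableSet_Ioo).integrableOn
  simp_rw [dist_eq_norm]
  rw [lintegral_sub_right_eq_self (fun z => ENNReal.ofReal (Q ‖z‖)) c,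
    ← ofReal_integral_eq_lintegral_ofReal hQi
      (Filter.Eventually.of_forall fun z => indicator_apply_nonneg fun h => hq0 _ h),
    integral_fun_norm_addHaar, hcomp, setIntegral_indicator measurableSet_Ioo, inter_comm, hsub,
    finrank_euclideanSpace_fin, Measure.real, EuclideanSpace.volume_ball_fin_two]
  congr 1
  simp [ENNReal.toReal_ofReal Real.pi_pos.le]
  ring

open Filter Topology in
/-- A radial capacity profile built from an increasing function `G` with derivative `g`. -/
theorem exists_isCapacityProfile {Psi : ℝ → ℝ} (hPsi0 : Psi 0 = 0)
    {c : EuclideanSpace ℝ (Fin 2)} {r R B : ℝ} (hr : 0 < r) (hrR : r < R) {G g : ℝ → ℝ}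
    (hG : ∀ s ∈ Icc r R, HasDerivAt G (g s) s) (hgc : ContinuousOn g (Icc r R))
    (hg : ∀ s ∈ Icc r R, 0 ≤ g s) (hA : 0 < G R - G r) (hB : 0 ≤ B)
    (hPsi : ∀ s ∈ Ioo r R, ∀ t, 0 ≤ t → t ≤ g s / (G R - G r) →
      s * Psi t ≤ B * (g s / (G R - G r))) :
    ∃ v, IsCapacityProfile Psi c r R (2 * Real.pi * B) v := by
  set A := G R - G r with hAdef
  -- Clamping the radius to `[r, R]` makes `(G (cl |z - c|) - G r) / A` constant off the annulus and
  -- globally Lipschitz.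
  set cl : ℝ → ℝ := fun s => max (min s R) r with hcl
  have hclm : ∀ s, cl s ∈ Icc r R := fun s =>
    ⟨le_max_right _ _, max_le (min_le_right _ _) hrR.le⟩
  have hcll : LipschitzWith 1 cl := (LipschitzWith.id.min_const R).max_const r
  have hmono : MonotoneOn G (Icc r R) := by
    refine monotoneOn_of_deriv_nonneg (convex_Icc r R)
      (fun s hs => (hG s hs).continuousAt.continuousWithinAt)
      (fun s hs => (hG s (interior_subset hs)).differentiableAt.differentiableWithinAt)
      fun s hs => ?_
    rw [(hG s (interior_subset hs)).deriv]
    exact hg s (interior_subset hs)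
  obtain ⟨M, hM⟩ := isCompact_Icc.exists_bound_of_continuousOn hgc
  have hM0 : 0 ≤ M := (norm_nonneg _).trans (hM r ⟨le_rfl, hrR.le⟩)
  lift M to NNReal using hM0
  have hGl : LipschitzOnWith M G (Icc r R) :=
    (convex_Icc r R).lipschitzOnWith_of_nnnorm_hasDerivWithin_le
      (fun s hs => (hG s hs).hasDerivWithinAt) fun s hs => hM s hs
  have hGc : LipschitzWith M fun s => G (cl s) := by
    have := (hGl.comp (hcll.lipschitzOnWith (s := univ)) fun s _ => hclm s)
    rwa [mul_one, lipschitzOnWith_univ] at this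
  have hvl : LipschitzWith (M * ‖1 / A‖₊) fun z => (G (cl (dist z c)) - G r) / A := by
    refine LipschitzWith.of_dist_le_mul fun z w => ?_
    have h1 := (hGc.comp (LipschitzWith.dist_left c)).dist_le_mul z w
    simp only [Function.comp, mul_one] at h1
    rw [Real.dist_eq, ← sub_div, sub_sub_sub_cancel_right, div_eq_mul_one_div, abs_mul,
      ← Real.dist_eq, NNReal.coe_mul, mul_right_comm]
    exact mul_le_mul_of_nonneg_right h1 (abs_nonneg _)
  refine ⟨fun z => (G (cl (dist z c)) - G r) / A, ⟨_, hvl⟩, fun z => ?_, fun z hz => ?_,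
    fun z hz => ?_, fun i => ?_⟩
  · exact div_nonneg (sub_nonneg.2 (hmono ⟨le_rfl, hrR.le⟩ (hclm _) (hclm _).1)) hA.le
  · have : cl (dist z c) = r := max_eq_right ((min_le_left _ _).trans hz)
    simp [this]
  · have : cl (dist z c) = R := by
      simp only [hcl]
      rw [min_eq_right hz, max_eq_left hrR.le]
    simp only [this]
    exact div_self hA.ne'
  set e : EuclideanSpace ℝ (Fin 2) := EuclideanSpace.single i 1
  have he : ‖e‖ = 1 := by simp [e]
  -- `q` is the bound on `Psi` of the partial derivative supplied by `hPsi`. Since `g` integrates to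
  -- `A`, the polar integral of `q` is exactly `2πB`.
  set q : ℝ → ℝ := fun s => B * (g s / A) / s with hq
  have hqc : ContinuousOn q (Icc r R) :=
    (continuousOn_const.mul (hgc.div_const A)).div continuousOn_id fun s hs =>
      (hr.trans_le hs.1).ne'
  have hq0 : ∀ s ∈ Ioo r R, 0 ≤ q s := fun s hs => div_nonneg (mul_nonneg hB
    (div_nonneg (hg s (Ioo_subset_Icc_self hs)) hA.le)) (hr.trans hs.1).le
  have hint : ∫ s in Ioo r R, s * q s = B := by
    have h1 : ∫ s in Ioo r R, s * q s = ∫ s in Ioo r R, B * (g s / A) := by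
      refine setIntegral_congr_fun measurableSet_Ioo fun s hs => ?_
      simp only [hq]
      rw [mul_div_cancel₀ _ (hr.trans hs.1).ne']
    rw [h1, integral_const_mul, integral_div, ← integral_Ioc_eq_integral_Ioo,
      ← intervalIntegral.integral_of_le hrR.le, intervalIntegral.integral_eq_sub_of_hasDerivAt
        (f := G) (fun s hs => hG s (by rwa [uIcc_of_le hrR.le] at hs))
        (ContinuousOn.intervalIntegrable (by rwa [uIcc_of_le hrR.le])), ← hAdef, div_self hA.ne',
      mul_one]
  rw [← hint, ← lintegral_annulus_radial hr hqc hq0 c]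
  refine lintegral_mono_ae ?_
  have hsph : ∀ t : ℝ, ∀ᵐ z : EuclideanSpace ℝ (Fin 2), dist z c ≠ t := fun t => by
    rw [ae_iff]
    simp only [not_not]
    exact Measure.addHaar_sphere volume c t
  filter_upwards [hsph r, hsph R] with z hzr hzR
  have hdc : Continuous fun w => dist w c := continuous_id.dist continuous_const
  rcases lt_or_gt_of_ne hzr with h1 | h1
  · have : (fun w => (G (cl (dist w c)) - G r) / A) =ᶠ[𝓝 z] fun _ => 0 := by
      filter_upwards [hdc.continuousAt.eventually_lt_const h1] with w hw
      have : cl (dist w c) = r := max_eq_right ((min_le_left _ _).trans hw.le)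
      simp [this]
    rw [this.fderiv_eq]
    simp [hPsi0]
  rcases lt_or_gt_of_ne hzR with h2 | h2
  · have hzI : dist z c ∈ Ioo r R := ⟨h1, h2⟩
    have hev : (fun w => (G (cl (dist w c)) - G r) / A) =ᶠ[𝓝 z]
        fun w => (G (dist w c) - G r) / A := by
      filter_upwards [hdc.continuousAt.eventually_lt_const h2,
        hdc.continuousAt.eventually_const_lt h1] with w hw hw'
      simp only [hcl]
      rw [min_eq_left hw.le, max_eq_left hw'.le]
    have hzc : z ≠ c := fun h => by
      rw [h, dist_self] at h1
      exact absurd h1 hr.not_gt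
    have hdd : DifferentiableAt ℝ (fun w => dist w c) z :=
      DifferentiableAt.dist ℝ differentiableAt_id (differentiableAt_const c) hzc
    have hd := (((hG _ (Ioo_subset_Icc_self hzI)).sub_const (G r)).div_const A).comp_hasFDerivAt z
      hdd.hasFDerivAt
    have hdn : |fderiv ℝ (fun w => dist w c) z e| ≤ 1 := by
      have h3 := (fderiv ℝ (fun w => dist w c) z).le_opNorm e
      have h4 := norm_fderiv_le_of_lipschitz ℝ (LipschitzWith.dist_left c) (x₀ := z)
      rw [he, mul_one] at h3
      exact h3.trans (by simpa using h4)
    have hgA : 0 ≤ g (dist z c) / A := div_nonneg (hg _ (Ioo_subset_Icc_self hzI)) hA.le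
    have hd' : HasFDerivAt (fun w => (G (dist w c) - G r) / A) _ z := hd
    rw [hev.fderiv_eq, hd'.fderiv, indicator_of_mem hzI]
    refine ENNReal.ofReal_le_ofReal ?_
    simp only [hq]
    rw [le_div_iff₀ (hr.trans h1), mul_comm]
    -- A partial derivative is only bounded by the radial slope `g / A`, which is why `hPsi` covers
    -- every smaller `t`: `Psi` need not be monotone.
    refine hPsi _ hzI _ (abs_nonneg _) ?_
    rw [_root_.smul_apply, smul_eq_mul, abs_mul, abs_of_nonneg hgA]
    exact mul_le_of_le_one_right hgA hdn
  · have : (fun w => (G (cl (dist w c)) - G r) / A) =ᶠ[𝓝 z] fun _ => 1 := by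
      filter_upwards [hdc.continuousAt.eventually_const_lt h2] with w hw
      have : cl (dist w c) = R := by
        simp only [hcl]
        rw [min_eq_right hw.le, max_eq_left hrR.le]
      simp only [this]
      exact div_self hA.ne'
    rw [this.fderiv_eq]
    simp [hPsi0]

/-! ### Growth of the Orlicz function and logarithmic comparisons -/

theorem one_le_log_exp_one_add {t : ℝ} (ht : 0 ≤ t) : 1 ≤ Real.log (Real.exp 1 + t) := by
  rw [Real.le_log_iff_exp_le (by positivity)]
  linarith

/-- `Ψ` is increasing up to a multiplicative constant. -/
theorem exists_orliczFun_le_mul {p : ℝ} (hp : 0 < p) (lam : ℝ) :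
    ∃ C, 0 ≤ C ∧ ∀ t T : ℝ, 0 ≤ t → t ≤ T → orliczFun p lam t ≤ C * orliczFun p lam T := by
  rcases le_or_gt 0 lam with hl | hl
  · refine ⟨1, zero_le_one, fun t T ht htT => ?_⟩
    rw [one_mul, orliczFun, orliczFun]
    have := one_le_log_exp_one_add ht
    have := Real.rpow_nonneg (ht.trans htT) p
    gcongr
  · have hε : 0 < p / -lam := div_pos hp (neg_pos.2 hl)
    -- With this exponent, raising `h3` to the power `-lam` produces exactly `(T / t) ^ p`, which
    -- the factor `t ^ p` absorbs.
    set ε := p / -lam with hεdef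
    have hD : 0 ≤ (1 + 1 / ε) := by positivity
    refine ⟨(1 + 1 / ε) ^ (-lam), Real.rpow_nonneg hD _, fun t T ht htT => ?_⟩
    rcases ht.eq_or_lt with rfl | ht0
    · rw [orliczFun_zero hp.ne']
      exact mul_nonneg (Real.rpow_nonneg hD _) (orliczFun_nonneg htT)
    have hT0 := ht0.trans_le htT
    have hr : 1 ≤ T / t := (one_le_div ht0).2 htT
    have h1 := one_le_log_exp_one_add ht
    have h2 := one_le_log_exp_one_add hT0.le
    have h3 : Real.log (Real.exp 1 + T) ≤
        Real.log (Real.exp 1 + t) * ((1 + 1 / ε) * (T / t) ^ ε) := by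
      have h4 : Real.log (Real.exp 1 + T) ≤ Real.log (Real.exp 1 + t) + Real.log (T / t) := by
        rw [← Real.log_mul (by positivity) (by positivity)]
        refine Real.log_le_log (by positivity) ?_
        rw [add_mul, mul_div_cancel₀ _ ht0.ne']
        nlinarith [Real.exp_pos 1]
      have h5 := Real.log_le_rpow_div (zero_le_one.trans hr) hε
      have h6 := Real.one_le_rpow hr hε.le
      have h7 : Real.log (T / t) ≤ Real.log (Real.exp 1 + t) * Real.log (T / t) :=
        le_mul_of_one_le_left (Real.log_nonneg hr) h1
      have h8 : 1 + Real.log (T / t) ≤ (1 + 1 / ε) * (T / t) ^ ε := by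
        rw [add_mul, one_mul, one_div_mul_eq_div]
        linarith
      nlinarith
    have h9 := Real.rpow_le_rpow (by linarith) h3 (neg_nonneg.2 hl.le)
    rw [Real.mul_rpow (by linarith) (by positivity), Real.mul_rpow hD (by positivity),
      ← Real.rpow_mul (by positivity), hεdef, div_mul_cancel₀ _ (neg_ne_zero.2 hl.ne),
      ← hεdef, Real.div_rpow hT0.le ht0.le] at h9
    rw [orliczFun, orliczFun]
    have e1 : Real.log (Real.exp 1 + t) ^ lam = (Real.log (Real.exp 1 + t) ^ (-lam))⁻¹ := by
      rw [Real.rpow_neg (by linarith), inv_inv]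
    have e2 : Real.log (Real.exp 1 + T) ^ lam = (Real.log (Real.exp 1 + T) ^ (-lam))⁻¹ := by
      rw [Real.rpow_neg (by linarith), inv_inv]
    have p1 : 0 < Real.log (Real.exp 1 + t) ^ (-lam) := Real.rpow_pos_of_pos (by linarith) _
    have p2 : 0 < Real.log (Real.exp 1 + T) ^ (-lam) := Real.rpow_pos_of_pos (by linarith) _
    have p3 : 0 < t ^ p := Real.rpow_pos_of_pos ht0 _
    rw [e1, e2, ← div_eq_mul_inv, ← div_eq_mul_inv, ← mul_div_assoc, div_le_div_iff₀ p1 p2]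
    calc t ^ p * Real.log (Real.exp 1 + T) ^ (-lam)
        ≤ t ^ p * (Real.log (Real.exp 1 + t) ^ (-lam) *
          ((1 + 1 / ε) ^ (-lam) * (T ^ p / t ^ p))) := by gcongr
      _ = _ := by field_simp

/-- The comparison is two-sided because the sign of `lam` is free: the upper bound on `y` serves
`lam ≥ 0`, the lower one `lam < 0`. -/
theorem rpow_le_mul_rpow_of_comparable {x y k lam : ℝ} (hx : 0 < x) (hk : 1 ≤ k)
    (h1 : x / k ≤ y) (h2 : y ≤ k * x) : y ^ lam ≤ k ^ |lam| * x ^ lam := by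
  have hk0 : 0 < k := by linarith
  have hy : 0 < y := (div_pos hx hk0).trans_le h1
  rcases le_or_gt 0 lam with hl | hl
  · rw [abs_of_nonneg hl, ← Real.mul_rpow hk0.le hx.le]
    exact Real.rpow_le_rpow hy.le h2 hl
  · rw [abs_of_neg hl, Real.rpow_neg hk0.le, ← Real.inv_rpow hk0.le,
      ← Real.mul_rpow (by positivity) hx.le]
    refine Real.rpow_le_rpow_of_nonpos (by positivity) ?_ hl.le
    rwa [inv_mul_eq_div]

theorem log_exp_one_add_le {x y : ℝ} (hx : 4 ≤ x) (hy : 0 ≤ y) (hyx : y ≤ 2 * x) :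
    Real.log (Real.exp 1 + y) ≤ 2 * Real.log x := by
  have : (2 : ℝ) * Real.log x = Real.log (x ^ 2) := by simp
  rw [this]
  refine Real.log_le_log (by positivity) ?_
  nlinarith [Real.exp_one_lt_d9]

theorem four_le_of_four_le_log {x : ℝ} (hx : 0 < x) (h : 4 ≤ Real.log x) : 4 ≤ x := by
  linarith [Real.log_le_sub_one_of_pos hx]

/-! ### The linear, logarithmic and iterated logarithmic profiles -/

/-- Linear profiles: the `Ψ`-energy in the annulus of radii `l / 2` and `l`. -/
theorem exists_isCapacityProfile_linear {p : ℝ} (hp : 0 < p) (lam : ℝ) :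
    ∃ K, ∀ (l : ℝ) (c : EuclideanSpace ℝ (Fin 2)), 0 < l → 4 ≤ Real.log (1 / l) →
      ∃ v, IsCapacityProfile (orliczFun p lam) c (l / 2) l
        (K * (l ^ (2 - p) * Real.log (1 / l) ^ lam)) v := by
  obtain ⟨C, hC0, hC⟩ := exists_orliczFun_le_mul hp lam
  refine ⟨2 * Real.pi * (C * 2 ^ p * 2 ^ |lam| / 2), fun l c hl hL => ?_⟩
  have h4 := four_le_of_four_le_log (one_div_pos.2 hl) hL
  have hL0 : 0 < Real.log (1 / l) := by linarith
  have hlL : 0 ≤ l ^ (2 - p) * Real.log (1 / l) ^ lam := by positivity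
  rw [mul_assoc]
  refine exists_isCapacityProfile (G := id) (g := fun _ => 1) (orliczFun_zero hp.ne')
    (by positivity) (by linarith) (fun s _ => hasDerivAt_id s) continuousOn_const
    (fun _ _ => zero_le_one) (by simp only [id]; linarith) (by positivity) ?_
  intro s hs t ht htT
  simp only [id] at htT ⊢
  have hA : 1 / (l - l / 2) = 2 * (1 / l) := by field_simp; ring
  rw [hA] at htT ⊢
  have h5 : Real.log (Real.exp 1 + 2 * (1 / l)) ^ lam ≤ 2 ^ |lam| * Real.log (1 / l) ^ lam := by
    refine rpow_le_mul_rpow_of_comparable hL0 one_le_two ?_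
      (log_exp_one_add_le h4 (by positivity) le_rfl)
    refine (half_le_self hL0.le).trans (Real.log_le_log (by positivity) ?_)
    linarith [Real.exp_pos 1]
  calc s * orliczFun p lam t ≤ l * (C * orliczFun p lam (2 * (1 / l))) := by
        refine mul_le_mul hs.2.le (hC _ _ ht htT) (orliczFun_nonneg ht) hl.le
    _ ≤ l * (C * ((2 * (1 / l)) ^ p * (2 ^ |lam| * Real.log (1 / l) ^ lam))) := by
        rw [orliczFun]
        gcongr
    _ = _ := by
        have : l * (1 / l) ^ p = l ^ (2 - p) * (1 / l) := by
          rw [one_div, Real.inv_rpow hl.le, Real.rpow_sub hl, Real.rpow_two]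
          field_simp
        rw [Real.mul_rpow zero_le_two (by positivity)]
        linear_combination (C * 2 ^ p * 2 ^ |lam| * Real.log (1 / l) ^ lam) * this

/-- Logarithmic profiles: the energy in the annulus of radii `l / 2` and `√l / 2` for `p = 2`. -/
theorem exists_isCapacityProfile_log (lam : ℝ) :
    ∃ K, ∀ (l : ℝ) (c : EuclideanSpace ℝ (Fin 2)), 0 < l → 4 ≤ Real.log (1 / l) →
      ∃ v, IsCapacityProfile (orliczFun 2 lam) c (l / 2) (Real.sqrt l / 2)
        (K * Real.log (1 / l) ^ (lam - 1)) v := by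
  obtain ⟨C, hC0, hC⟩ := exists_orliczFun_le_mul (p := 2) two_pos lam
  refine ⟨2 * Real.pi * (C * 2 * 4 ^ |lam|), fun l c hl hL => ?_⟩
  have h4 := four_le_of_four_le_log (one_div_pos.2 hl) hL
  set L := Real.log (1 / l) with hLdef
  have hL0 : 0 < L := by linarith
  have hLl : Real.log l = -L := by rw [hLdef, one_div, Real.log_inv, neg_neg]
  have hl1 : l < 1 := by
    by_contra! h
    linarith [Real.log_nonneg h]
  have hsq : 0 < Real.sqrt l := Real.sqrt_pos.2 hl
  have hss : Real.sqrt l * Real.sqrt l = l := Real.mul_self_sqrt hl.le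
  have hsq1 : l < Real.sqrt l := by
    have : Real.sqrt l < 1 := by rw [Real.sqrt_lt' one_pos]; simpa using hl1
    nlinarith
  have hA : Real.log (Real.sqrt l / 2) - Real.log (l / 2) = L / 2 := by
    rw [Real.log_div hsq.ne' two_ne_zero, Real.log_div hl.ne' two_ne_zero, Real.log_sqrt hl.le, hLl]
    ring
  rw [mul_assoc]
  refine exists_isCapacityProfile (G := Real.log) (g := fun s => s⁻¹) (orliczFun_zero two_ne_zero)
    (by positivity) (by linarith)
    (fun s hs => Real.hasDerivAt_log ((half_pos hl).trans_le hs.1).ne')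
    (continuousOn_inv₀.mono fun s hs => ((half_pos hl).trans_le hs.1).ne')
    (fun s hs => inv_nonneg.2 ((half_pos hl).trans_le hs.1).le)
    (by rw [hA]; positivity) (by positivity) ?_
  intro s hs t ht htT
  rw [hA] at htT ⊢
  have hs0 : 0 < s := (half_pos hl).trans hs.1
  -- `T` is the slope of the profile. As `s * T = 2 / L` and `log (e + T)` is comparable to `L`, the
  -- product `s * Ψ(T)` is of order `T * L ^ (lam - 1)`.
  set T := s⁻¹ / (L / 2) with hT
  have hT0 : 0 < T := by positivity
  have hsT : s * T = 2 / L := by rw [hT]; field_simp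
  have hTu : T ≤ 2 * (1 / l) := by
    rw [hT, div_le_iff₀ (by positivity), inv_le_comm₀ hs0 (by positivity)]
    refine le_trans ?_ hs.1.le
    rw [inv_le_comm₀ (by positivity) (by positivity)]
    have : (l / 2)⁻¹ = 2 * (1 / l) := by field_simp
    rw [this]
    exact le_mul_of_one_le_right (by positivity) (by linarith)
  -- The outer radius `√l / 2` keeps `log (1 / s)` above `L / 2`, and the loss `log L` is absorbed
  -- by `log (L / 4) ≤ L / 4 - 1`.
  have hTl : L / 4 ≤ Real.log T := by
    have e1 : Real.log T = -Real.log s - (Real.log L - Real.log 2) := by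
      rw [hT, Real.log_div (by positivity) (by positivity), Real.log_inv,
        Real.log_div hL0.ne' two_ne_zero]
    have e2 : Real.log s ≤ -L / 2 - Real.log 2 := by
      have := Real.log_le_log hs0 hs.2.le
      rwa [Real.log_div hsq.ne' two_ne_zero, Real.log_sqrt hl.le, hLl] at this
    have e3 := Real.log_le_sub_one_of_pos (show 0 < L / 4 by positivity)
    have e4 : Real.log (L / 4) = Real.log L - 2 * Real.log 2 := by
      rw [Real.log_div hL0.ne' (by norm_num), show (4 : ℝ) = 2 ^ 2 by norm_num, Real.log_pow]
      norm_num
    linarith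
  have h5 : Real.log (Real.exp 1 + T) ^ lam ≤ 4 ^ |lam| * L ^ lam := by
    refine rpow_le_mul_rpow_of_comparable hL0 (by norm_num) ?_ ?_
    · exact hTl.trans (Real.log_le_log hT0 (by linarith [Real.exp_pos 1]))
    · have := log_exp_one_add_le h4 hT0.le hTu
      linarith
  calc s * orliczFun 2 lam t ≤ s * (C * orliczFun 2 lam T) := by
        have := hC _ _ ht htT
        gcongr
    _ ≤ s * (C * (T ^ (2 : ℝ) * (4 ^ |lam| * L ^ lam))) := by
        rw [orliczFun]
        gcongr
    _ = _ := by
        rw [Real.rpow_two, Real.rpow_sub_one hL0.ne']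
        linear_combination (C * T * 4 ^ |lam| * L ^ lam) * hsT

/-- Iterated logarithmic profiles: the energy for `Ψ(t) = t ^ 2 * log (e + t)` in the annulus of
radii `l / 2` and `gapRadius l`. -/
theorem exists_isCapacityProfile_loglog :
    ∃ K, ∀ (l : ℝ) (c : EuclideanSpace ℝ (Fin 2)), 0 < l → 16 ≤ Real.log (1 / l) →
      ∃ v, IsCapacityProfile (orliczFun 2 1) c (l / 2) (gapRadius l)
        (K * (Real.log (Real.log (1 / l)))⁻¹) v := by
  obtain ⟨C, hC0, hC⟩ := exists_orliczFun_le_mul (p := 2) two_pos 1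
  refine ⟨2 * Real.pi * (C * 4), fun l c hl hL => ?_⟩
  rw [gapRadius]
  set L := Real.log (1 / l) with hLdef
  have hL0 : 0 < L := by linarith
  have hLl : Real.log l = -L := by rw [hLdef, one_div, Real.log_inv, neg_neg]
  have hq4 : 4 ≤ Real.sqrt L := Real.le_sqrt_of_sq_le (by linarith)
  have hqq : Real.sqrt L * Real.sqrt L = L := Real.mul_self_sqrt hL0.le
  have hlog1 : 1 ≤ Real.log L := by
    rw [Real.le_log_iff_exp_le hL0]
    linarith [Real.exp_one_lt_d9]
  have hlR : l / 2 < Real.exp (-Real.sqrt L) := by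
    refine (half_lt_self hl).trans_le ?_
    rw [← Real.exp_log hl, hLl, Real.exp_le_exp]
    nlinarith
  have hτ : ∀ s ∈ Icc (l / 2) (Real.exp (-Real.sqrt L)),
      0 < s ∧ Real.sqrt L ≤ -Real.log s := fun s hs => by
    have hs0 := (half_pos hl).trans_le hs.1
    refine ⟨hs0, ?_⟩
    have := Real.log_le_log hs0 hs.2
    rw [Real.log_exp] at this
    linarith
  -- The outer radius has `-log = √L` and the inner one at least `L`, so the iterated logarithm
  -- increases by at least half of `log L`.
  have hA : Real.log L / 2 ≤ -Real.log (-Real.log (Real.exp (-Real.sqrt L))) -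
      -Real.log (-Real.log (l / 2)) := by
    rw [Real.log_exp, neg_neg, Real.log_sqrt hL0.le, Real.log_div hl.ne' two_ne_zero, hLl]
    have := Real.log_le_log hL0 (show L ≤ -(-L - Real.log 2) by
      linarith [Real.log_pos one_lt_two])
    linarith
  set A := -Real.log (-Real.log (Real.exp (-Real.sqrt L))) - -Real.log (-Real.log (l / 2)) with hAd
  have hA0 : 0 < A := by linarith
  rw [mul_assoc]
  refine exists_isCapacityProfile (G := fun s => -Real.log (-Real.log s))
    (g := fun s => s⁻¹ / -Real.log s) (orliczFun_zero two_ne_zero) (by positivity) hlR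
    (fun s hs => ?_) (ContinuousOn.div (continuousOn_inv₀.mono fun s hs => (hτ s hs).1.ne')
      (Real.continuousOn_log.mono fun s hs => (hτ s hs).1.ne').neg
      fun s hs => by linarith [(hτ s hs).2]) (fun s hs => ?_) hA0 ?_ ?_
  · obtain ⟨h1, h2⟩ := hτ s hs
    have := ((Real.hasDerivAt_log h1.ne').neg.log (by
      rw [Pi.neg_apply]; linarith)).neg
    rwa [neg_div, neg_neg] at this
  · exact div_nonneg (inv_nonneg.2 (hτ s hs).1.le) (by linarith [(hτ s hs).2])
  · exact mul_nonneg (by positivity) (inv_nonneg.2 (by linarith))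
  intro s hs t ht htT
  obtain ⟨hs0, hsτ⟩ := hτ s (Ioo_subset_Icc_self hs)
  simp only [← hAd] at htT ⊢
  set τ := -Real.log s with hτd
  have hτ0 : 0 < τ := by linarith
  set T := s⁻¹ / τ / A with hT
  have hT0 : 0 < T := by positivity
  have hTs : T ≤ 1 / s := by
    rw [hT, div_div, div_eq_mul_inv, one_div]
    refine mul_le_of_le_one_right (by positivity) (inv_le_one_of_one_le₀ ?_)
    nlinarith
  have hlogs : Real.log (1 / s) = τ := by rw [one_div, Real.log_inv]
  have h5 : Real.log (Real.exp 1 + T) ≤ 2 * τ := by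
    have h6 := four_le_of_four_le_log (one_div_pos.2 hs0) (by rw [hlogs]; linarith)
    have := log_exp_one_add_le h6 hT0.le (by linarith)
    rwa [hlogs] at this
  -- The factor `τ` from the bound on `log (e + T)` cancels the one in the slope, leaving an energy
  -- of order `1 / A`.
  have hsT : s * T * τ = A⁻¹ := by rw [hT]; field_simp
  have hAinv : A⁻¹ ≤ 2 * (Real.log L)⁻¹ := by
    rw [inv_le_comm₀ hA0 (mul_pos two_pos (inv_pos.2 (by linarith))), mul_inv, inv_inv]
    linarith
  calc s * orliczFun 2 1 t ≤ s * (C * orliczFun 2 1 T) := by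
        have := hC _ _ ht htT
        gcongr
    _ ≤ s * (C * (T ^ 2 * (2 * τ))) := by
        rw [orliczFun, Real.rpow_two, Real.rpow_one]
        gcongr
    _ = C * T * 2 * A⁻¹ := by linear_combination (C * T * 2) * hsT
    _ ≤ C * T * 2 * (2 * (Real.log L)⁻¹) := by gcongr
    _ = _ := by ring

/-! ### Gap lengths and the three cases -/

theorem summable_gap_lengths {ι : Type*} [Countable ι] {a b : ι → ℝ} (hab : ∀ j, a j < b j)
    (hdisj : Pairwise fun i j => Disjoint (Ioo (a i) (b i)) (Ioo (a j) (b j)))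
    (hsub : ⋃ j, Ioo (a j) (b j) ⊆ Ioo 0 1) : Summable fun j => b j - a j := by
  have h := measure_mono (μ := volume) hsub
  rw [measure_iUnion hdisj fun _ => measurableSet_Ioo] at h
  have := ENNReal.summable_toReal (h.trans_lt measure_Ioo_lt_top).ne
  refine this.congr fun j => ?_
  rw [Real.volume_Ioo, ENNReal.toReal_ofReal (sub_nonneg.2 (hab j).le)]

theorem gap_length_le_one {ι : Type*} {a b : ι → ℝ} (hab : ∀ j, a j < b j)
    (hsub : ⋃ j, Ioo (a j) (b j) ⊆ Ioo 0 1) (j : ι) : b j - a j ≤ 1 := by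
  have := closure_mono ((subset_iUnion _ j).trans hsub)
  rw [closure_Ioo (hab j).ne, closure_Ioo zero_ne_one, Icc_subset_Icc_iff (hab j).le] at this
  linarith [this.1, this.2]

theorem Ioo_subset_dilateIoo {c x y : ℝ} (hc : 1 ≤ c) (hxy : x < y) :
    Ioo x y ⊆ dilateIoo c x y :=
  Ioo_subset_Ioo (by nlinarith) (by nlinarith)

theorem mainTheorem4 {ι : Type*} [Countable ι] (E : Set ℝ) (a b : ι → ℝ)
    (hE : IsCompact E) (hE01 : E ⊆ Set.Ioo 0 1)
    (hab : ∀ j, a j < b j)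
    (hdisj : Pairwise fun i j => Disjoint (Set.Ioo (a i) (b i)) (Set.Ioo (a j) (b j)))
    (hunion : Set.Ioo 0 1 \ E = ⋃ j, Set.Ioo (a j) (b j)) :
    (∀ p lam : ℝ, ((1 < p ∧ p < 2) ∨ (p = 1 ∧ 0 ≤ lam)) →
      0 < MeasureTheory.Measure.hausdorffMeasure 1 E →
      Summable (fun j => (b j - a j) ^ (2 - p) * Real.log (1 / (b j - a j)) ^ lam) →
      ¬ IsPLRemovable p lam E) ∧
    (∀ lam : ℝ, lam < 1 →
      0 < MeasureTheory.Measure.hausdorffMeasure 1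
        (Set.Ioo (0 : ℝ) 1 \ ⋃ j, dilateIoo ((b j - a j) ^ (-(1 / 2) : ℝ)) (a j) (b j)) →
      Summable (fun j => Real.log (1 / (b j - a j)) ^ (lam - 1)) →
      ¬ IsPLRemovable 2 lam E) ∧
    (0 < MeasureTheory.Measure.hausdorffMeasure 1 E →
      0 < MeasureTheory.Measure.hausdorffMeasure 1
        (Set.Ioo (0 : ℝ) 1 \ ⋃ j, dilateIoo (gapRadius (b j - a j) / (b j - a j)) (a j) (b j)) →
      Summable (fun j => (Real.log (Real.log (1 / (b j - a j))))⁻¹) →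
      ¬ IsPLRemovable 2 1 E) := by
  rw [hausdorffMeasure_real]
  have hsub : ⋃ j, Ioo (a j) (b j) ⊆ Ioo 0 1 := hunion ▸ sdiff_subset
  have hl0 : ∀ j, 0 < b j - a j := fun j => sub_pos.2 (hab j)
  have hls := summable_gap_lengths hab hdisj hsub
  have hLt : Filter.Tendsto (fun j => Real.log (1 / (b j - a j))) Filter.cofinite Filter.atTop := by
    refine Real.tendsto_log_atTop.comp ?_
    simp_rw [one_div]
    exact tendsto_inv_nhdsGT_zero.comp (tendsto_nhdsWithin_iff.2
      ⟨hls.tendsto_cofinite_zero, Filter.Eventually.of_forall fun j => hl0 j⟩)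
  refine ⟨fun p lam hp hpos hsum => ?_, fun lam hlam hpos hsum => ?_, fun hpos _ hsum => ?_⟩
  · have hp0 : 0 < p := by rcases hp with h | h <;> linarith [h.1]
    obtain ⟨K, hK⟩ := exists_isCapacityProfile_linear hp0 lam
    refine not_isPLRemovable_of_isCapacityProfile hp0 hE hE01 hunion hpos.ne' hls
      (hsum.mul_left K) ?_
    filter_upwards [hLt.eventually_ge_atTop 4] with j hj
    exact hK _ _ (hl0 j) hj
  · obtain ⟨K, hK⟩ := exists_isCapacityProfile_log lam
    -- Gap lengths are at most 1, so the dilation factor is at least 1 and the dilated gaps cover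
    -- the gaps; what they leave of the unit interval lies in `E`.
    have hEpos : 0 < volume E := by
      refine hpos.trans_le (measure_mono fun x hx => ?_)
      by_contra hxE
      obtain ⟨j, hj⟩ := mem_iUnion.1 (hunion.subset ⟨hx.1, hxE⟩)
      refine hx.2 (mem_iUnion.2 ⟨j, Ioo_subset_dilateIoo ?_ (hab j) hj⟩)
      exact Real.one_le_rpow_of_pos_of_le_one_of_nonpos (hl0 j)
        (gap_length_le_one hab hsub j) (by norm_num)
    -- With `L = log (1 / l)` one has `√l = exp (-L / 2)`, eventually below `L ^ (lam - 1)`, so the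
    -- energy series dominates the radii.
    have hρ : Summable fun j => Real.sqrt (b j - a j) / 2 := by
      refine hsum.of_norm_bounded_eventually ?_
      have h1 := (tendsto_rpow_mul_exp_neg_mul_atTop_nhds_zero (1 - lam) (1 / 2)
        (by norm_num)).comp hLt
      filter_upwards [h1.eventually_lt_const zero_lt_one, hLt.eventually_ge_atTop 1] with j hj hj1
      have hL0 : 0 < Real.log (1 / (b j - a j)) := by linarith
      have h2 : Real.sqrt (b j - a j) = Real.exp (-(1 / 2) * Real.log (1 / (b j - a j))) := by
        rw [← Real.exp_log (Real.sqrt_pos.2 (hl0 j)), Real.log_sqrt (hl0 j).le, one_div (b j - a j),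
          Real.log_inv]
        ring_nf
      simp only [Function.comp] at hj
      rw [← h2] at hj
      rw [Real.norm_of_nonneg (by positivity), ← neg_sub 1 lam, Real.rpow_neg hL0.le]
      refine (half_le_self (Real.sqrt_nonneg _)).trans ?_
      rw [← one_div, le_div_iff₀ (by positivity), mul_comm]
      exact hj.le
    refine not_isPLRemovable_of_isCapacityProfile two_pos hE hE01 hunion hEpos.ne' hρ
      (hsum.mul_left K) ?_
    filter_upwards [hLt.eventually_ge_atTop 4] with j hj
    exact hK _ _ (hl0 j) hj
  · obtain ⟨K, hK⟩ := exists_isCapacityProfile_loglog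
    -- Again the energy series dominates: `log L = 2 log √L ≤ 2 exp √L` gives `exp (-√L) ≤ 2 / log
    -- L`.
    have hρ : Summable fun j => gapRadius (b j - a j) := by
      refine (hsum.mul_left 2).of_norm_bounded_eventually ?_
      filter_upwards [hLt.eventually_ge_atTop 16] with j hj
      rw [gapRadius, Real.norm_of_nonneg (Real.exp_pos _).le]
      set L := Real.log (1 / (b j - a j))
      have hL0 : 0 < L := by linarith
      have h1 : 0 < Real.log L := Real.log_pos (by linarith)
      have h2 : Real.log L ≤ 2 * Real.exp (Real.sqrt L) := by
        have h3 := Real.log_le_sub_one_of_pos (Real.sqrt_pos.2 hL0)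
        rw [Real.log_sqrt hL0.le] at h3
        linarith [Real.add_one_le_exp (Real.sqrt L)]
      rw [Real.exp_neg, ← div_eq_mul_inv, le_div_iff₀ h1, inv_mul_le_iff₀ (Real.exp_pos _)]
      linarith
    refine not_isPLRemovable_of_isCapacityProfile two_pos hE hE01 hunion hpos.ne' hρ
      (hsum.mul_left K) ?_
    filter_upwards [hLt.eventually_ge_atTop 16] with j hj
    exact hK _ _ (hl0 j) hj
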